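/- Let $\Omega\subset\mathbb{R}^n$ be a bounded domain (non-empty, open, connected) whose boundary is of class $C^{2,\alpha}$ for some $\alpha\in[0,1)$, and let $\mathscr A=(a^{hk})$ be an $n\times n$ matrix of complex valued functions $a^{hk}\in C^1(\overline\Omega)$. For $1<p<\infty$ consider the operator $$Au=\nabla^t(\mathscr A\nabla u)=\sum_{h,k}\partial_h(a^{hk}\partial_k u),\qquad D(A)=W^{2,p}(\Omega)\cap W^{1,p}_0(\Omega),$$ on complex valued functions. $A$ is called $L^p$-dissipative if $$\operatorname{Re}\int_\Omega\langle Au,u\rangle\,|u|^{p-2}\,dx\le 0\qquad\text{for all }u\in D(A),$$ where $\langle z,w\rangle=z\overline w$ and the integrand is understood to be zero where $u=0$. Let $\operatorname{Re}\mathscr A$, $\operatorname{Im}\mathscr A$ denote the entrywise real and imaginary parts of $\mathscr A$. Suppose that $\operatorname{Im}\mathscr A(x)$ is symmetric for every $x\in\Omega$ and that $\langle\operatorname{Re}\mathscr A(x)\xi,\xi\rangle\ge 0$ for all $x\in\Omega$, $\xi\in\mathbb{R}^n$. (i) If $\operatorname{Im}\mathscr A(x)=0$ for every $x\in\Omega$,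 then $A$ is $L^p$-dissipative for every $p>1$. (ii) If $\operatorname{Im}\mathscr A$ does not vanish identically on $\Omega$, put $$\lambda=\inf\left\{\frac{\langle\operatorname{Re}\mathscr A(x)\xi,\xi\rangle}{|\langle\operatorname{Im}\mathscr A(x)\xi,\xi\rangle|}\ :\ x\in\Omega,\ \xi\in\mathbb{R}^n,\ \langle\operatorname{Im}\mathscr A(x)\xi,\xi\rangle\ne 0\right\}.$$ Then, for $p\in(1,\infty)$, $A$ is $L^p$-dissipative if and only if $$2+2\lambda\bigl(\lambda-\sqrt{\lambda^2+1}\bigr)\le p\le 2+2\lambda\bigl(\lambda+\sqrt{\lambda^2+1}\bigr),$$ and every real $p$ satisfying these inequalities is greater than $1$. -/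

import Mathlib

open MeasureTheory Filter Topology
open scoped NNReal ENNReal Matrix

noncomputable section

/-- `C₀¹(Ω)`: complex valued continuously differentiable functions with compact support in `Ω`. -/
def IsC01 {n : ℕ} (Ω : Set (EuclideanSpace ℝ (Fin n)))
    (φ : EuclideanSpace ℝ (Fin n) → ℂ) : Prop :=
  ContDiff ℝ 1 φ ∧ HasCompactSupport φ ∧ tsupport φ ⊆ Ω

/-- The classical partial derivative `∂ᵢ φ (x)`. -/
def classicalPartial {n : ℕ} (i : Fin n) (φ : EuclideanSpace ℝ (Fin n) → ℂ)
    (x : EuclideanSpace ℝ (Fin n)) : ℂ :=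
  fderiv ℝ φ x (EuclideanSpace.single i 1)

/-- `v` is a weak partial derivative `∂ᵢ u` in `Ω`: both functions are locally integrable in `Ω`
and `∫_Ω u ∂ᵢφ = - ∫_Ω v φ` for every `φ ∈ C₀¹(Ω)`. -/
def HasWeakPartial {n : ℕ} (Ω : Set (EuclideanSpace ℝ (Fin n))) (i : Fin n)
    (u v : EuclideanSpace ℝ (Fin n) → ℂ) : Prop :=
  LocallyIntegrableOn u Ω ∧ LocallyIntegrableOn v Ω ∧
    ∀ φ : EuclideanSpace ℝ (Fin n) → ℂ, IsC01 Ω φ →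
      ∫ x in Ω, u x * classicalPartial i φ x = - ∫ x in Ω, v x * φ x

open Classical in
/-- The weak partial derivative `∂ᵢ u` in `Ω`, determined up to null sets (a representative is
chosen); it is `0` by convention if `u` has no such derivative. -/
def weakPartial {n : ℕ} (Ω : Set (EuclideanSpace ℝ (Fin n))) (i : Fin n)
    (u : EuclideanSpace ℝ (Fin n) → ℂ) : EuclideanSpace ℝ (Fin n) → ℂ :=
  if h : ∃ v, HasWeakPartial Ω i u v then h.choose else 0

/-- `u ∈ W^{1,q}(Ω)`. -/
def MemW1 {n : ℕ} (Ω : Set (EuclideanSpace ℝ (Fin n))) (q : ℝ≥0∞)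
    (u : EuclideanSpace ℝ (Fin n) → ℂ) : Prop :=
  MemLp u q (volume.restrict Ω) ∧
    ∀ i, ∃ v, HasWeakPartial Ω i u v ∧ MemLp v q (volume.restrict Ω)

/-- `u ∈ W^{2,q}(Ω)`. -/
def MemW2 {n : ℕ} (Ω : Set (EuclideanSpace ℝ (Fin n))) (q : ℝ≥0∞)
    (u : EuclideanSpace ℝ (Fin n) → ℂ) : Prop :=
  MemLp u q (volume.restrict Ω) ∧
    ∀ i, ∃ v, HasWeakPartial Ω i u v ∧ MemW1 Ω q v

/-- `u ∈ W₀^{1,q}(Ω)`, the closure of `C₀¹(Ω)` in `W^{1,q}(Ω)`. -/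
def MemW10 {n : ℕ} (Ω : Set (EuclideanSpace ℝ (Fin n))) (q : ℝ≥0∞)
    (u : EuclideanSpace ℝ (Fin n) → ℂ) : Prop :=
  MemW1 Ω q u ∧
    ∃ φ : ℕ → EuclideanSpace ℝ (Fin n) → ℂ, (∀ m, IsC01 Ω (φ m)) ∧
      Tendsto (fun m => eLpNorm (fun x => φ m x - u x) q (volume.restrict Ω)) atTop (𝓝 0) ∧
      ∀ i, Tendsto
        (fun m => eLpNorm (fun x => classicalPartial i (φ m) x - weakPartial Ω i u x) q
          (volume.restrict Ω)) atTop (𝓝 0)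

/-- `f ∈ C¹(Ω̄)`: `f` is continuous on the closure of `Ω`, continuously differentiable in the open
set `Ω`, and its derivative extends continuously to the closure of `Ω`. -/
def IsC1Closure {n : ℕ} (Ω : Set (EuclideanSpace ℝ (Fin n)))
    (f : EuclideanSpace ℝ (Fin n) → ℂ) : Prop :=
  ContinuousOn f (closure Ω) ∧ ContDiffOn ℝ 1 f Ω ∧
    ∃ G : EuclideanSpace ℝ (Fin n) → EuclideanSpace ℝ (Fin n) →L[ℝ] ℂ,
      ContinuousOn G (closure Ω) ∧ Set.EqOn (fderiv ℝ f) G Ω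

/-- The boundary of `Ω` is of class `C^{2,α}`: near each boundary point, `Ω` is the set where a
`C^{2,α}` function with non-zero gradient is negative. -/
def HasC2HolderBoundary {n : ℕ} (α : ℝ≥0) (Ω : Set (EuclideanSpace ℝ (Fin n))) : Prop :=
  ∀ x₀ ∈ frontier Ω, ∃ (U : Set (EuclideanSpace ℝ (Fin n)))
      (ρ : EuclideanSpace ℝ (Fin n) → ℝ) (C : ℝ≥0),
    IsOpen U ∧ x₀ ∈ U ∧ ContDiffOn ℝ 2 ρ U ∧
      HolderOnWith C α (fun x => fderiv ℝ (fderiv ℝ ρ) x) U ∧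
      (∀ x ∈ U, fderiv ℝ ρ x ≠ 0) ∧
      Ω ∩ U = {x | ρ x < 0} ∩ U

/-- `Au = ∇ᵗ(𝒜 ∇u) = ∑ₕ ∂ₕ (∑ₖ a^{hk} ∂ₖ u)`, with weak derivatives in `Ω`. -/
def divFormOp {n : ℕ} (Ω : Set (EuclideanSpace ℝ (Fin n)))
    (A : EuclideanSpace ℝ (Fin n) → Matrix (Fin n) (Fin n) ℂ)
    (u : EuclideanSpace ℝ (Fin n) → ℂ) (x : EuclideanSpace ℝ (Fin n)) : ℂ :=
  ∑ h, weakPartial Ω h (fun y => ∑ k, A y h k * weakPartial Ω k u y) x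

/-- `A = ∇ᵗ(𝒜 ∇·)` with domain `W^{2,p}(Ω) ∩ W₀^{1,p}(Ω)` is `L^p`-dissipative:
`Re ∫_Ω ⟨Au, u⟩ |u|^{p-2} dx ≤ 0` for all `u` in the domain. The integrand is zero where `u` is. -/
def IsLpDissipative {n : ℕ} (Ω : Set (EuclideanSpace ℝ (Fin n)))
    (A : EuclideanSpace ℝ (Fin n) → Matrix (Fin n) (Fin n) ℂ) (p : ℝ) : Prop :=
  ∀ u : EuclideanSpace ℝ (Fin n) → ℂ,
    MemW2 Ω (ENNReal.ofReal p) u → MemW10 Ω (ENNReal.ofReal p) u →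
      (∫ x in Ω, divFormOp Ω A u x * (starRingEnd ℂ) (u x) * ((‖u x‖ ^ (p - 2) : ℝ) : ℂ)).re ≤ 0

/-- The real quadratic form `⟨Bξ, ξ⟩`. -/
def quadForm {n : ℕ} (B : Matrix (Fin n) (Fin n) ℝ) (ξ : Fin n → ℝ) : ℝ :=
  (B *ᵥ ξ) ⬝ᵥ ξ

/-- The entrywise real part of a complex matrix. -/
def reMat {n : ℕ} (B : Matrix (Fin n) (Fin n) ℂ) : Matrix (Fin n) (Fin n) ℝ :=
  B.map Complex.re

/-- The entrywise imaginary part of a complex matrix. -/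
def imMat {n : ℕ} (B : Matrix (Fin n) (Fin n) ℂ) : Matrix (Fin n) (Fin n) ℝ :=
  B.map Complex.im

/-- `λ`, the infimum of `⟨Re 𝒜(x)ξ, ξ⟩ / |⟨Im 𝒜(x)ξ, ξ⟩|` over all `x ∈ Ω`, `ξ ∈ ℝⁿ` with
`⟨Im 𝒜(x)ξ, ξ⟩ ≠ 0`. -/
def lambdaInf {n : ℕ} (Ω : Set (EuclideanSpace ℝ (Fin n)))
    (A : EuclideanSpace ℝ (Fin n) → Matrix (Fin n) (Fin n) ℂ) : ℝ :=
  sInf {r : ℝ | ∃ x ∈ Ω, ∃ ξ : Fin n → ℝ, quadForm (imMat (A x)) ξ ≠ 0 ∧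
    r = quadForm (reMat (A x)) ξ / |quadForm (imMat (A x)) ξ|}

end

/-! Write R = Re 𝒜 and S = Im 𝒜. Formally, integrating by parts against |u|^{p-2}u turns -Re ∫
⟨Au,u⟩|u|^{p-2} into the integral of |u|^{p-4} [(p-1)⟨RX,X⟩ + ⟨RY,Y⟩ - (p-2)⟨SY,X⟩], where X + iY =
ū∇u. By polarization, λ|⟨Sξ,ξ⟩| ≤ ⟨Rξ,ξ⟩ makes the bracket non-negative as soon as (p-2)² ≤
4λ²(p-1). Solved for p, this is the stated interval.

Sufficiency (`isLpDissipative_of_form_nonneg`). Two regularizations justify the integration by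
parts. The power |u|^{p-2} is replaced by a bounded smooth k_ε(|u|²), which changes p-2 into a
number τ between 0 and p-2 depending on the point; the condition survives because τ²/(1+τ) on that
interval is largest at τ = p-2 (`sq_le_of_mem_uIcc`). The integrand is quadratic in ∇u, which is
only known to lie in L^p, so for p < 2 its integrability is unclear; hence ∇u is replaced in the
flux by ∇u/(1+κ|∇u|²). This factor is a non-negative scalar, so it preserves the sign of the form.
The chain rule `hasWeakPartial_comp` differentiates the truncated flux. The limit is taken on the
side of Au, where no product of gradients occurs and everything is dominated uniformly in the
parameters.

Necessity (`IsLpDissipative.wave_leading_nonneg`). The test functions are u = α exp((1+ic)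
sin(t⟨ξ,x⟩+β)) with α a localized bump. The sine keeps |u| bounded above, and bounded below relative
to α, uniformly in t, while ∇u grows like t cos(t⟨ξ,x⟩+β). Adding the cases β = 0 and β = π/2
replaces cos² by 1, and t → ∞ gives (p-1+c²)⟨Rξ,ξ⟩ - (p-2)c⟨Sξ,ξ⟩ ≥ 0 at every point. The choice c =
±√(p-1) gives |p-2| |⟨Sξ,ξ⟩| ≤ 2√(p-1)⟨Rξ,ξ⟩, hence |p-2| ≤ 2λ√(p-1). -/

noncomputable section

/-! ### Dominated subsequences in `L^p` and a convergence criterion in `L¹` -/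

section Dominated

variable {α F : Type*} [MeasurableSpace α] {μ : Measure α} [NormedAddCommGroup F]

/-- A sequence converging fast in `L^p` converges almost everywhere and is dominated by an `L^p`
function. -/
theorem ae_tendsto_and_dominated_of_eLpNorm_sub_le {p : ℝ≥0∞} (hp1 : 1 ≤ p) (hp : p ≠ ∞)
    {f : ℕ → α → F} {g : α → F} (hf : ∀ m, AEStronglyMeasurable (f m) μ) (hg : MemLp g p μ)
    (h : ∀ m, eLpNorm (fun x => f m x - g x) p μ ≤ 2⁻¹ ^ m) :
    (∀ᵐ x ∂μ, Tendsto (fun j => f j x) atTop (𝓝 (g x))) ∧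
      ∃ Φ : α → ℝ, MemLp Φ p μ ∧ ∀ᵐ x ∂μ, ∀ j, ‖f j x‖ ≤ Φ x := by
  have hp0 : p ≠ 0 := (zero_lt_one.trans_le hp1).ne'
  have hpr : 0 < p.toReal := ENNReal.toReal_pos hp0 hp
  have hd : ∀ m, AEStronglyMeasurable (fun x => f m x - g x) μ := fun m => (hf m).sub hg.1
  have hde : ∀ m, AEMeasurable (fun x => ‖f m x - g x‖ₑ) μ := fun m => (hd m).enorm
  -- S is the sum of all the errors. Minkowski and the geometric series bound its partial sums in
  -- `L^p`, and monotone convergence passes the bound to S. Finiteness of S a.e. then makes the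
  -- errors tend to zero, and ‖g‖ + S is the dominating function.
  set S : α → ℝ≥0∞ := fun x => ∑' m, ‖f m x - g x‖ₑ with hS
  have hSm : AEMeasurable S μ := AEMeasurable.tsum hde
  have hpart : ∀ N, ∫⁻ x, (∑ m ∈ Finset.range N, ‖f m x - g x‖ₑ) ^ p.toReal ∂μ ≤
      2 ^ p.toReal := by
    intro N
    have h1 : eLpNorm (∑ m ∈ Finset.range N, fun x => ‖f m x - g x‖ₑ) p μ ≤ 2 := by
      refine (eLpNorm_sum_le (fun m _ => (hde m).aestronglyMeasurable) hp1).trans ?_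
      calc ∑ m ∈ Finset.range N, eLpNorm (fun x => ‖f m x - g x‖ₑ) p μ
          ≤ ∑ m ∈ Finset.range N, 2⁻¹ ^ m := by
            refine Finset.sum_le_sum fun m _ => le_trans (le_of_eq ?_) (h m)
            exact eLpNorm_enorm _
        _ ≤ ∑' m : ℕ, (2⁻¹ : ℝ≥0∞) ^ m := ENNReal.sum_le_tsum _
        _ = 2 := by rw [ENNReal.tsum_geometric, ENNReal.one_sub_inv_two, inv_inv]
    rw [eLpNorm_eq_lintegral_rpow_enorm_toReal hp0 hp] at h1
    have h2 := ENNReal.rpow_le_rpow h1 hpr.le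
    rw [← ENNReal.rpow_mul, one_div_mul_cancel hpr.ne', ENNReal.rpow_one] at h2
    simpa using h2
  have hSp : ∫⁻ x, S x ^ p.toReal ∂μ ≤ 2 ^ p.toReal := by
    have : ∀ x, S x ^ p.toReal = ⨆ N, (∑ m ∈ Finset.range N, ‖f m x - g x‖ₑ) ^ p.toReal := by
      intro x
      rw [hS]
      simp only [ENNReal.tsum_eq_iSup_nat]
      exact (ENNReal.orderIsoRpow p.toReal hpr).map_iSup _
    simp_rw [this]
    rw [lintegral_iSup']
    · exact iSup_le hpart
    · intro N
      exact (Finset.aemeasurable_fun_sum _ fun m _ => hde m).pow_const _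
    · refine Eventually.of_forall fun x N M hNM => ?_
      refine ENNReal.rpow_le_rpow ?_ hpr.le
      exact Finset.sum_le_sum_of_subset (Finset.range_mono hNM)
  have hfin : ∀ᵐ x ∂μ, S x < ∞ := by
    have h1 : ∀ᵐ x ∂μ, S x ^ p.toReal < ∞ := by
      refine ae_lt_top' (hSm.pow_const _) (ne_of_lt (hSp.trans_lt ?_))
      exact ENNReal.rpow_lt_top_of_nonneg hpr.le (by simp)
    filter_upwards [h1] with x hx
    exact (ENNReal.rpow_lt_top_iff_of_pos hpr).1 hx
  refine ⟨?_, fun x => ‖g x‖ + (S x).toReal, hg.norm.add ?_, ?_⟩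
  · filter_upwards [hfin] with x hx
    have h1 := ENNReal.tendsto_atTop_zero_of_tsum_ne_top hx.ne
    rw [tendsto_iff_norm_sub_tendsto_zero]
    have h2 := (ENNReal.tendsto_toReal ENNReal.zero_ne_top).comp h1
    simpa [Function.comp_def] using h2
  · refine ⟨hSm.ennreal_toReal.aestronglyMeasurable, ?_⟩
    rw [eLpNorm_eq_lintegral_rpow_enorm_toReal hp0 hp]
    refine ENNReal.rpow_lt_top_of_nonneg (by positivity) (ne_of_lt ?_)
    calc ∫⁻ x, ‖(S x).toReal‖ₑ ^ p.toReal ∂μ ≤ ∫⁻ x, S x ^ p.toReal ∂μ := by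
          refine lintegral_mono fun x => ENNReal.rpow_le_rpow ?_ hpr.le
          rw [Real.enorm_eq_ofReal ENNReal.toReal_nonneg]
          exact ENNReal.ofReal_toReal_le
      _ < ∞ := hSp.trans_lt (ENNReal.rpow_lt_top_of_nonneg hpr.le (by simp))
  · filter_upwards [hfin] with x hx j
    have h1 : ‖f j x - g x‖ ≤ (S x).toReal := by
      rw [← toReal_enorm]
      exact ENNReal.toReal_mono hx.ne (ENNReal.le_tsum j)
    calc ‖f j x‖ = ‖g x + (f j x - g x)‖ := by congr 1; abel
      _ ≤ _ := (norm_add_le _ _).trans (by gcongr)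

/-- Finitely many sequences converging in `L^p` have a common subsequence along which they converge
almost everywhere and are dominated by `L^p` functions. -/
theorem exists_subseq_ae_tendsto_and_dominated {ι : Type*} [Finite ι] {p : ℝ≥0∞} (hp1 : 1 ≤ p)
    (hp : p ≠ ∞) {f : ι → ℕ → α → F} {g : ι → α → F}
    (hf : ∀ i m, AEStronglyMeasurable (f i m) μ) (hg : ∀ i, MemLp (g i) p μ)
    (h : ∀ i, Tendsto (fun m => eLpNorm (fun x => f i m x - g i x) p μ) atTop (𝓝 0)) :
    ∃ ns : ℕ → ℕ, StrictMono ns ∧ ∀ i,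
      (∀ᵐ x ∂μ, Tendsto (fun j => f i (ns j) x) atTop (𝓝 (g i x))) ∧
      ∃ Φ : α → ℝ, MemLp Φ p μ ∧ ∀ᵐ x ∂μ, ∀ j, ‖f i (ns j) x‖ ≤ Φ x := by
  have hev : ∀ j : ℕ, ∀ᶠ m in atTop, ∀ i,
      eLpNorm (fun x => f i m x - g i x) p μ ≤ 2⁻¹ ^ j := by
    intro j
    rw [eventually_all]
    exact fun i => (h i).eventually_le_const (ENNReal.pow_pos (by simp) j)
  obtain ⟨ns, hns, hle⟩ := extraction_forall_of_eventually hev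
  exact ⟨ns, hns, fun i => ae_tendsto_and_dominated_of_eLpNorm_sub_le hp1 hp
    (fun m => hf i (ns m)) (hg i) fun m => hle m i⟩

/-- Almost everywhere convergence together with `∫ ‖f m‖ ≤ ∫ ‖g‖` implies convergence in `L¹`. -/
theorem tendsto_eLpNorm_one_sub_of_integral_norm_le {f : ℕ → α → F} {g : α → F}
    (hf : ∀ m, Integrable (f m) μ) (hg : Integrable g μ)
    (hlim : ∀ᵐ x ∂μ, Tendsto (fun m => f m x) atTop (𝓝 (g x)))
    (hle : ∀ m, ∫ x, ‖f m x‖ ∂μ ≤ ∫ x, ‖g x‖ ∂μ) :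
    Tendsto (fun m => eLpNorm (fun x => f m x - g x) 1 μ) atTop (𝓝 0) := by
  have hd : ∀ m, Integrable (fun x => f m x - g x) μ := fun m => (hf m).sub hg
  -- The Brezis–Lieb device: |‖f m‖ - ‖f m - g‖| ≤ ‖g‖, so this difference, unlike `f m` itself, is
  -- dominated.
  have h1 : Tendsto (fun m => ∫ x, (‖f m x‖ - ‖f m x - g x‖) ∂μ) atTop (𝓝 (∫ x, ‖g x‖ ∂μ)) := by
    refine tendsto_integral_of_dominated_convergence (fun x => ‖g x‖)
      (fun m => ((hf m).norm.sub (hd m).norm).1) hg.norm (fun m => ?_) ?_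
    · refine Eventually.of_forall fun x => ?_
      rw [Real.norm_eq_abs]
      simpa using abs_norm_sub_norm_le (f m x) (f m x - g x)
    · filter_upwards [hlim] with x hx
      have := hx.norm.sub (hx.sub_const (g x)).norm
      simpa using this
  have h2 : Tendsto (fun m => ∫ x, ‖f m x - g x‖ ∂μ) atTop (𝓝 0) := by
    have h3 : Tendsto (fun m => ∫ x, ‖g x‖ ∂μ - ∫ x, (‖f m x‖ - ‖f m x - g x‖) ∂μ) atTop
        (𝓝 0) := by simpa using h1.const_sub (∫ x, ‖g x‖ ∂μ)
    refine squeeze_zero (fun m => integral_nonneg fun x => norm_nonneg _) (fun m => ?_) h3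
    rw [integral_sub (hf m).norm (hd m).norm]
    linarith [hle m]
  have h4 := ENNReal.tendsto_ofReal h2
  rw [ENNReal.ofReal_zero] at h4
  refine h4.congr fun m => ?_
  rw [eLpNorm_one_eq_lintegral_enorm, ofReal_integral_norm_eq_lintegral_enorm (hd m)]

end Dominated

/-! ### Mollification: convergence and commutation with weak derivatives -/

section Mollify

variable {E H : Type*} [NormedAddCommGroup E] [NormedSpace ℝ E] [FiniteDimensional ℝ E]
  [MeasurableSpace E] [BorelSpace E] {μ : Measure E} [μ.IsAddHaarMeasure]
  [NormedAddCommGroup H] [NormedSpace ℝ H]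

open scoped Convolution
open ContinuousLinearMap (lsmul)

/-- The kernel is non-negative with integral one. This is the bound which upgrades a.e. convergence
of mollifications to convergence in `L¹`, without a density argument. -/
theorem integral_norm_mollify_le (η : ContDiffBump (0 : E)) {g : E → H} (hg : Integrable g μ) :
    ∫ x, ‖(η.normed μ ⋆[lsmul ℝ ℝ, μ] g) x‖ ∂μ ≤ ∫ x, ‖g x‖ ∂μ := by
  have hη : Integrable (η.normed μ) μ := η.integrable_normed
  have h1 : ∫ x, (η.normed μ ⋆[lsmul ℝ ℝ, μ] fun y => ‖g y‖) x ∂μ = ∫ x, ‖g x‖ ∂μ := by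
    rw [integral_convolution _ hη hg.norm, η.integral_normed]
    simp
  rw [← h1]
  refine integral_mono_of_nonneg (Eventually.of_forall fun x => norm_nonneg _)
    (hη.integrable_convolution _ hg.norm) (Eventually.of_forall fun x => ?_)
  simp only [convolution_def]
  refine (norm_integral_le_integral_norm _).trans (le_of_eq ?_)
  refine integral_congr_ae (Eventually.of_forall fun t => ?_)
  simp [norm_smul, abs_of_nonneg (η.nonneg_normed t)]

/-- A standard sequence of bump functions shrinking to a point. -/
def shrinkingBump (E : Type*) [NormedAddCommGroup E] [NormedSpace ℝ E] [HasContDiffBump E]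
    (j : ℕ) : ContDiffBump (0 : E) :=
  ⟨1 / (j + 1), 2 / (j + 1), by positivity, by gcongr; norm_num⟩

/-- Lebesgue differentiation. It needs the ratio of outer to inner radius to stay bounded; for
`shrinkingBump` it is always 2. -/
theorem ae_tendsto_mollify [CompleteSpace H] {g : E → H} (hg : LocallyIntegrable g μ) :
    ∀ᵐ x ∂μ, Tendsto (fun j => ((shrinkingBump E j).normed μ ⋆[lsmul ℝ ℝ, μ] g) x) atTop
      (𝓝 (g x)) := by
  refine ContDiffBump.ae_convolution_tendsto_right_of_locallyIntegrable (K := 2) ?_ ?_ hg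
  · have := (tendsto_one_div_add_atTop_nhds_zero_nat (𝕜 := ℝ)).const_mul 2
    simpa [shrinkingBump, div_eq_mul_inv] using this
  · refine Eventually.of_forall fun j => le_of_eq ?_
    simp [shrinkingBump, div_eq_mul_inv]

theorem tendsto_eLpNorm_mollify_sub [CompleteSpace H] {g : E → H} (hg : Integrable g μ) :
    Tendsto (fun j => eLpNorm
      (fun x => ((shrinkingBump E j).normed μ ⋆[lsmul ℝ ℝ, μ] g) x - g x) 1 μ) atTop (𝓝 0) :=
  tendsto_eLpNorm_one_sub_of_integral_norm_le
    (fun j => (shrinkingBump E j).integrable_normed.integrable_convolution _ hg) hg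
    (ae_tendsto_mollify hg.locallyIntegrable) (fun _ => integral_norm_mollify_le _ hg)

/-- If `g` is the weak derivative of `f` in the direction `e` on the whole space, then the
derivative of a mollification of `f` is the mollification of `g`. -/
theorem fderiv_mollify_apply (η : ContDiffBump (0 : E)) {f g : E → H} {e : E}
    (hf : LocallyIntegrable f μ)
    (hfg : ∀ φ : E → ℝ, ContDiff ℝ 1 φ → HasCompactSupport φ →
      ∫ x, fderiv ℝ φ x e • f x ∂μ = - ∫ x, φ x • g x ∂μ) (x : E) :
    fderiv ℝ (η.normed μ ⋆[lsmul ℝ ℝ, μ] f) x e = (η.normed μ ⋆[lsmul ℝ ℝ, μ] g) x := by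
  have hη : ContDiff ℝ 1 (η.normed μ) := η.contDiff_normed
  have hηc : HasCompactSupport (η.normed μ) := η.hasCompactSupport_normed
  rw [(hηc.hasFDerivAt_convolution_left (lsmul ℝ ℝ) hη hf x).fderiv]
  have hex : ConvolutionExistsAt (fderiv ℝ (η.normed μ)) f x
      ((lsmul ℝ ℝ : ℝ →L[ℝ] H →L[ℝ] H).precompL E) μ :=
    (hηc.fderiv ℝ).convolutionExists_left _ (hη.continuous_fderiv (by norm_num)) hf x
  have hx : ContDiff ℝ 1 (fun y : E => x - y) := contDiff_const.sub contDiff_id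
  -- The weak derivative is tested against the reflected kernel y ↦ η(x - y), whose derivative in y
  -- is minus that of η at x - y; the two signs cancel.
  have h1 := hfg (fun y => η.normed μ (x - y)) (hη.comp hx)
    (hηc.comp_homeomorph (Homeomorph.subLeft x))
  have h2 : ∀ y, fderiv ℝ (fun y => η.normed μ (x - y)) y e =
      - fderiv ℝ (η.normed μ) (x - y) e := by
    intro y
    have hd : HasFDerivAt (fun y : E => x - y) (-ContinuousLinearMap.id ℝ E) y := by
      simpa using (hasFDerivAt_id y).const_sub x
    have h3 := ((hη.differentiable (by norm_num) (x - y)).hasFDerivAt.comp y hd).fderiv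
    rw [Function.comp_def] at h3
    rw [h3]
    simp
  simp only [h2, neg_smul, integral_neg, neg_inj] at h1
  rw [convolution_lsmul_swap, ← h1, convolution_def, ContinuousLinearMap.integral_apply hex,
    ← integral_sub_left_eq_self _ μ x]
  simp [ContinuousLinearMap.precompL_apply]
end Mollify

/-! ### Calculus of weak derivatives in an open set -/

section WeakDerivatives

variable {n : ℕ} {Ω : Set (EuclideanSpace ℝ (Fin n))}

theorem integrable_smul_of_hasCompactSupport {𝕜 H : Type*} [NormedField 𝕜] [NormedAddCommGroup H]
    [NormedSpace 𝕜 H] {f : EuclideanSpace ℝ (Fin n) → H} {φ : EuclideanSpace ℝ (Fin n) → 𝕜}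
    (hf : LocallyIntegrableOn f Ω) (hφ : Continuous φ) (hc : HasCompactSupport φ)
    (hs : tsupport φ ⊆ Ω) : Integrable (fun x => φ x • f x) := by
  have h1 : IntegrableOn f (tsupport φ) := hf.integrableOn_compact_subset hs hc
  have h2 : IntegrableOn (fun x => φ x • f x) (tsupport φ) :=
    h1.continuousOn_smul hφ.continuousOn hc
  refine (integrableOn_iff_integrable_of_support_subset ?_).1 h2
  intro x hx
  by_contra h
  exact hx (by simp [image_eq_zero_of_notMem_tsupport h])

theorem integrable_mul_of_hasCompactSupport
    {f φ : EuclideanSpace ℝ (Fin n) → ℂ}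
    (hf : LocallyIntegrableOn f Ω) (hφ : Continuous φ) (hc : HasCompactSupport φ)
    (hs : tsupport φ ⊆ Ω) : Integrable (fun x => f x * φ x) (volume.restrict Ω) := by
  have := (integrable_smul_of_hasCompactSupport hf hφ hc hs).restrict (s := Ω)
  simpa [mul_comm] using this

theorem setIntegral_eq_integral_of_tsupport_subset {F G : Type*} [Zero F]
    [NormedAddCommGroup G] [NormedSpace ℝ G] {φ : EuclideanSpace ℝ (Fin n) → F}
    {f : EuclideanSpace ℝ (Fin n) → G} (hs : tsupport φ ⊆ Ω) (h : ∀ x, φ x = 0 → f x = 0) :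
    ∫ x in Ω, f x = ∫ x, f x :=
  setIntegral_eq_integral_of_forall_compl_eq_zero fun x hx =>
    h x (image_eq_zero_of_notMem_tsupport fun h' => hx (hs h'))

theorem continuous_fderiv_apply_const {F : Type*} [NormedAddCommGroup F] [NormedSpace ℝ F]
    {φ : EuclideanSpace ℝ (Fin n) → F} (hφ : ContDiff ℝ 1 φ) (e : EuclideanSpace ℝ (Fin n)) :
    Continuous (fun x => fderiv ℝ φ x e) :=
  (hφ.continuous_fderiv (by norm_num)).clm_apply continuous_const

theorem IsC01.integrable_mul {f φ : EuclideanSpace ℝ (Fin n) → ℂ} (hφ : IsC01 Ω φ)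
    (hf : LocallyIntegrableOn f Ω) : Integrable (fun x => f x * φ x) (volume.restrict Ω) :=
  integrable_mul_of_hasCompactSupport hf hφ.1.continuous hφ.2.1 hφ.2.2

theorem IsC01.integrable_mul_classicalPartial {f φ : EuclideanSpace ℝ (Fin n) → ℂ}
    (hφ : IsC01 Ω φ) (hf : LocallyIntegrableOn f Ω) (i : Fin n) :
    Integrable (fun x => f x * classicalPartial i φ x) (volume.restrict Ω) :=
  integrable_mul_of_hasCompactSupport hf (continuous_fderiv_apply_const hφ.1 _)
    (hφ.2.1.fderiv_apply ℝ _) ((tsupport_fderiv_apply_subset ℝ _).trans hφ.2.2)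

/-- The fundamental lemma of the calculus of variations. It makes the representative chosen in
`weakPartial` immaterial. -/
theorem HasWeakPartial.ae_eq (hΩ : IsOpen Ω) {i : Fin n}
    {u v w : EuclideanSpace ℝ (Fin n) → ℂ} (hv : HasWeakPartial Ω i u v)
    (hw : HasWeakPartial Ω i u w) : v =ᵐ[volume.restrict Ω] w := by
  have h : ∀ᵐ x, x ∈ Ω → (v - w) x = 0 := by
    refine hΩ.ae_eq_zero_of_integral_contDiff_smul_eq_zero (hv.2.1.sub hw.2.1) ?_
    intro g hg hgc hgs
    have hC : IsC01 Ω (fun x => (g x : ℂ)) := by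
      have h0 : tsupport (fun x => (g x : ℂ)) ⊆ tsupport g :=
        closure_mono fun x hx h => hx (by simp [h])
      refine ⟨Complex.ofRealCLM.contDiff.comp (hg.of_le (by norm_cast)),
        hgc.of_isClosed_subset (isClosed_tsupport _) h0, h0.trans hgs⟩
    have h1 := (hv.2.2 _ hC).symm.trans (hw.2.2 _ hC)
    rw [neg_inj] at h1
    rw [← setIntegral_eq_integral_of_tsupport_subset hgs (fun x hx => by simp [hx])]
    have h2 := integral_sub (hC.integrable_mul hv.2.1) (hC.integrable_mul hw.2.1)
    rw [h1, sub_self] at h2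
    rw [← h2]
    refine integral_congr_ae (Eventually.of_forall fun x => ?_)
    simp only [Pi.sub_apply, Complex.real_smul]
    ring
  rw [EventuallyEq, ae_restrict_iff' hΩ.measurableSet]
  filter_upwards [h] with x hx hxΩ
  exact sub_eq_zero.1 (hx hxΩ)

theorem HasWeakPartial.congr {i : Fin n} {u v u' v' : EuclideanSpace ℝ (Fin n) → ℂ}
    (h : HasWeakPartial Ω i u v) (hu : u =ᵐ[volume.restrict Ω] u')
    (hv : v =ᵐ[volume.restrict Ω] v') : HasWeakPartial Ω i u' v' := by
  refine ⟨h.1.congr hu, h.2.1.congr hv, fun φ hφ => ?_⟩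
  have h1 : ∫ x in Ω, u' x * classicalPartial i φ x = ∫ x in Ω, u x * classicalPartial i φ x :=
    integral_congr_ae (by filter_upwards [hu] with x hx; rw [hx])
  have h2 : ∫ x in Ω, v' x * φ x = ∫ x in Ω, v x * φ x :=
    integral_congr_ae (by filter_upwards [hv] with x hx; rw [hx])
  rw [h1, h2, h.2.2 φ hφ]

theorem HasWeakPartial.hasWeakPartial_weakPartial {i : Fin n}
    {u v : EuclideanSpace ℝ (Fin n) → ℂ} (h : HasWeakPartial Ω i u v) :
    HasWeakPartial Ω i u (weakPartial Ω i u) := by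
  have h' : ∃ v, HasWeakPartial Ω i u v := ⟨v, h⟩
  rw [weakPartial, dif_pos h']
  exact h'.choose_spec

theorem HasWeakPartial.weakPartial_ae_eq (hΩ : IsOpen Ω) {i : Fin n}
    {u v : EuclideanSpace ℝ (Fin n) → ℂ} (h : HasWeakPartial Ω i u v) :
    weakPartial Ω i u =ᵐ[volume.restrict Ω] v :=
  h.hasWeakPartial_weakPartial.ae_eq hΩ h

theorem locallyIntegrableOn_mono_of_restrict {F G : Type*} [NormedAddCommGroup F]
    [NormedAddCommGroup G] {f : EuclideanSpace ℝ (Fin n) → F} {g : EuclideanSpace ℝ (Fin n) → G}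
    (hg : LocallyIntegrableOn g Ω) (hf : AEStronglyMeasurable f (volume.restrict Ω))
    (h : ∀ᵐ x ∂(volume.restrict Ω), ‖f x‖ ≤ ‖g x‖) : LocallyIntegrableOn f Ω := by
  intro x hx
  obtain ⟨t, ht, hgt⟩ := hg x hx
  refine ⟨t ∩ Ω, inter_mem ht self_mem_nhdsWithin, ?_⟩
  have hle : volume.restrict (t ∩ Ω) ≤ volume.restrict Ω :=
    Measure.restrict_mono Set.inter_subset_right le_rfl
  exact Integrable.mono (hgt.mono_set Set.inter_subset_left) (hf.mono_measure hle)
    (ae_mono hle h)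

theorem locallyIntegrableOn_finset_sum {ι : Type*} (s : Finset ι)
    {f : ι → EuclideanSpace ℝ (Fin n) → ℂ} (hf : ∀ k ∈ s, LocallyIntegrableOn (f k) Ω) :
    LocallyIntegrableOn (fun x => ∑ k ∈ s, f k x) Ω := by
  classical
  induction s using Finset.induction_on with
  | empty => simpa using locallyIntegrableOn_zero
  | insert a s ha ih =>
    simp only [Finset.sum_insert ha]
    exact (hf a (by simp)).add (ih fun k hk => hf k (by simp [hk]))

theorem HasWeakPartial.sum {ι : Type*} (s : Finset ι) {i : Fin n}
    {u v : ι → EuclideanSpace ℝ (Fin n) → ℂ} (h : ∀ k ∈ s, HasWeakPartial Ω i (u k) (v k)) :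
    HasWeakPartial Ω i (fun x => ∑ k ∈ s, u k x) (fun x => ∑ k ∈ s, v k x) := by
  refine ⟨locallyIntegrableOn_finset_sum s fun k hk => (h k hk).1,
    locallyIntegrableOn_finset_sum s fun k hk => (h k hk).2.1, fun φ hφ => ?_⟩
  simp only [Finset.sum_mul]
  rw [integral_finsetSum _ fun k hk => hφ.integrable_mul_classicalPartial (h k hk).1 i,
    integral_finsetSum _ fun k hk => hφ.integrable_mul (h k hk).2.1, ← Finset.sum_neg_distrib]
  exact Finset.sum_congr rfl fun k hk => (h k hk).2.2 φ hφ

theorem IsC01.mul_left (hΩ : IsOpen Ω) {a φ : EuclideanSpace ℝ (Fin n) → ℂ}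
    (ha : ContDiffOn ℝ 1 a Ω) (hφ : IsC01 Ω φ) : IsC01 Ω (fun x => a x * φ x) := by
  have h0 : tsupport (fun x => a x * φ x) ⊆ tsupport φ :=
    closure_mono fun x hx h => hx (by simp [h])
  refine ⟨contDiff_iff_contDiffAt.2 fun x => ?_,
    hφ.2.1.of_isClosed_subset (isClosed_tsupport _) h0, h0.trans hφ.2.2⟩
  by_cases hx : x ∈ Ω
  · exact (ha.contDiffAt (hΩ.mem_nhds hx)).mul hφ.1.contDiffAt
  · have h1 : φ =ᶠ[𝓝 x] 0 := notMem_tsupport_iff_eventuallyEq.1 fun h => hx (hφ.2.2 h)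
    refine (contDiffAt_const (c := (0 : ℂ))).congr_of_eventuallyEq ?_
    filter_upwards [h1] with y hy
    simp [hy]

theorem continuousOn_classicalPartial (hΩ : IsOpen Ω) {a : EuclideanSpace ℝ (Fin n) → ℂ}
    (ha : ContDiffOn ℝ 1 a Ω) (i : Fin n) : ContinuousOn (classicalPartial i a) Ω :=
  (ha.continuousOn_fderiv_of_isOpen hΩ le_rfl).clm_apply continuousOn_const

/-- The coefficient is moved onto the test function: aφ is again admissible, being zero near every
point outside Ω, and its classical product rule gives the two terms. -/
theorem HasWeakPartial.mul_left (hΩ : IsOpen Ω) {i : Fin n}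
    {a u v : EuclideanSpace ℝ (Fin n) → ℂ} (ha : ContDiffOn ℝ 1 a Ω)
    (h : HasWeakPartial Ω i u v) :
    HasWeakPartial Ω i (fun x => a x * u x) (fun x => classicalPartial i a x * u x + a x * v x) := by
  have hl := hΩ.isLocallyClosed
  have hda := continuousOn_classicalPartial hΩ ha i
  have i1 : LocallyIntegrableOn (fun x => a x * u x) Ω := h.1.continuousOn_mul ha.continuousOn hl
  have i2 : LocallyIntegrableOn (fun x => classicalPartial i a x * u x) Ω :=
    h.1.continuousOn_mul hda hl
  have i3 : LocallyIntegrableOn (fun x => a x * v x) Ω := h.2.1.continuousOn_mul ha.continuousOn hl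
  refine ⟨i1, i2.add i3, fun φ hφ => ?_⟩
  have h1 := h.2.2 _ (hφ.mul_left hΩ ha)
  have h2 : ∫ x in Ω, u x * classicalPartial i (fun x => a x * φ x) x =
      ∫ x in Ω, (a x * u x * classicalPartial i φ x + classicalPartial i a x * u x * φ x) := by
    refine setIntegral_congr_fun hΩ.measurableSet fun x hx => ?_
    have hd1 := ((ha.contDiffAt (hΩ.mem_nhds hx)).differentiableAt (by norm_num)).hasFDerivAt
    have hd2 := (hφ.1.differentiable (by norm_num) x).hasFDerivAt
    simp only [classicalPartial]
    have hd3 : fderiv ℝ (fun x => a x * φ x) x = _ := (hd1.mul hd2).fderiv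
    rw [hd3]
    simp only [add_apply, smul_apply, smul_eq_mul]
    ring
  rw [h2, integral_add (hφ.integrable_mul_classicalPartial i1 i) (hφ.integrable_mul i2)] at h1
  have h3 : ∫ x in Ω, (classicalPartial i a x * u x + a x * v x) * φ x =
      (∫ x in Ω, classicalPartial i a x * u x * φ x) + ∫ x in Ω, v x * (a x * φ x) := by
    rw [← integral_add (hφ.integrable_mul i2) ((hφ.mul_left hΩ ha).integrable_mul h.2.1)]
    refine integral_congr_ae (Eventually.of_forall fun x => ?_)
    simp only
    ring
  rw [h3, ← sub_eq_zero, ← sub_eq_zero.2 h1]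
  ring

theorem hasWeakPartial_classicalPartial (i : Fin n)
    {u : EuclideanSpace ℝ (Fin n) → ℂ} (hu : ContDiff ℝ 1 u) :
    HasWeakPartial Ω i u (classicalPartial i u) := by
  have hc : Continuous (classicalPartial i u) := continuous_fderiv_apply_const hu _
  refine ⟨hu.continuous.locallyIntegrable.locallyIntegrableOn _,
    hc.locallyIntegrable.locallyIntegrableOn _, fun φ hφ => ?_⟩
  have hφ' : Continuous (classicalPartial i φ) := continuous_fderiv_apply_const hφ.1 _
  rw [setIntegral_eq_integral_of_tsupport_subset
      (φ := classicalPartial i φ)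
      ((tsupport_fderiv_apply_subset ℝ (EuclideanSpace.single i 1)).trans hφ.2.2)
      (fun x hx => by simp [hx]),
    setIntegral_eq_integral_of_tsupport_subset hφ.2.2 (fun x hx => by simp [hx])]
  refine integral_mul_fderiv_eq_neg_fderiv_mul_of_integrable ?_ ?_ ?_
    (fun x _ => hu.differentiable (by norm_num) x)
    (fun x _ => hφ.1.differentiable (by norm_num) x)
  · exact (hc.mul hφ.1.continuous).integrable_of_hasCompactSupport hφ.2.1.mul_left
  · exact (hu.continuous.mul hφ').integrable_of_hasCompactSupport
      (hφ.2.1.fderiv_apply ℝ _).mul_left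
  · exact (hu.continuous.mul hφ.1.continuous).integrable_of_hasCompactSupport hφ.2.1.mul_left

/-- The derivative vanishes on K because χ attains its maximum 1 there. Thus f and χf, together with
their derivatives, agree on K. -/
theorem exists_cutoff {K : Set (EuclideanSpace ℝ (Fin n))} (hK : IsCompact K) (hΩ : IsOpen Ω)
    (hKΩ : K ⊆ Ω) : ∃ χ : EuclideanSpace ℝ (Fin n) → ℝ, ContDiff ℝ 1 χ ∧ HasCompactSupport χ ∧
      tsupport χ ⊆ Ω ∧ ∀ x ∈ K, χ x = 1 ∧ fderiv ℝ χ x = 0 := by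
  obtain ⟨L, hL, hKL, hLΩ⟩ := exists_compact_between hK hΩ hKΩ
  obtain ⟨χ, hχ, hr, hsupp, h1⟩ := exists_contMDiff_support_eq_eq_one_iff
    (modelWithCornersSelf ℝ (EuclideanSpace ℝ (Fin n))) (n := 1)
    (isOpen_interior (s := L)) hK.isClosed hKL
  have hts : tsupport χ ⊆ L := by
    rw [tsupport, hsupp]
    exact closure_minimal interior_subset hL.isClosed
  refine ⟨χ, hχ.contDiff, hL.of_isClosed_subset (isClosed_tsupport _) hts, hts.trans hLΩ,
    fun x hx => ⟨(h1 x).1 hx, ?_⟩⟩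
  refine IsLocalMax.fderiv_eq_zero (Eventually.of_forall fun y => ?_)
  rw [(h1 x).1 hx]
  exact (hr ⟨y, rfl⟩).2

/-! ### The chain rule for vector valued weakly differentiable functions -/

section ChainRule

variable {H : Type*} [NormedAddCommGroup H] [NormedSpace ℝ H]

/-- A weakly differentiable function may be multiplied by a cutoff function to yield a function
which is weakly differentiable on the whole space. -/
theorem weak_derivative_cutoff_smul {f g : EuclideanSpace ℝ (Fin n) → H}
    {e : EuclideanSpace ℝ (Fin n)} (hf : LocallyIntegrableOn f Ω) (hg : LocallyIntegrableOn g Ω)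
    (hfg : ∀ φ : EuclideanSpace ℝ (Fin n) → ℝ, ContDiff ℝ 1 φ → HasCompactSupport φ →
      tsupport φ ⊆ Ω → ∫ x in Ω, fderiv ℝ φ x e • f x = - ∫ x in Ω, φ x • g x)
    {χ : EuclideanSpace ℝ (Fin n) → ℝ} (hχ : ContDiff ℝ 1 χ) (hχc : HasCompactSupport χ)
    (hχΩ : tsupport χ ⊆ Ω) (ψ : EuclideanSpace ℝ (Fin n) → ℝ) (hψ : ContDiff ℝ 1 ψ) :
    ∫ x, fderiv ℝ ψ x e • (χ x • f x) = - ∫ x, ψ x • (fderiv ℝ χ x e • f x + χ x • g x) := by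
  have hp : ContDiff ℝ 1 (fun x => χ x * ψ x) := hχ.mul hψ
  have hpt : tsupport (fun x => χ x * ψ x) ⊆ tsupport χ :=
    closure_mono fun x hx h => hx (by simp [h])
  have h1 := hfg _ hp (hχc.of_isClosed_subset (isClosed_tsupport _) hpt) (hpt.trans hχΩ)
  have hdp : ∀ x, fderiv ℝ (fun x => χ x * ψ x) x e =
      χ x * fderiv ℝ ψ x e + ψ x * fderiv ℝ χ x e := by
    intro x
    have hd3 : fderiv ℝ (fun x => χ x * ψ x) x = _ :=
      ((hχ.differentiable (by norm_num) x).hasFDerivAt.mul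
        (hψ.differentiable (by norm_num) x).hasFDerivAt).fderiv
    rw [hd3]
    simp
  rw [setIntegral_eq_integral_of_tsupport_subset
      (φ := fun x => fderiv ℝ (fun x => χ x * ψ x) x e)
      (((tsupport_fderiv_apply_subset ℝ e).trans hpt).trans hχΩ) (fun x hx => by simp [hx]),
    setIntegral_eq_integral_of_tsupport_subset hχΩ (fun x hx => by simp [hx])] at h1
  have hdχ := continuous_fderiv_apply_const hχ e
  have hdψ := continuous_fderiv_apply_const hψ e
  have htdχ : tsupport (fun x => fderiv ℝ χ x e) ⊆ tsupport χ := tsupport_fderiv_apply_subset ℝ e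
  have sub1 : ∀ {θ : EuclideanSpace ℝ (Fin n) → ℝ},
      tsupport (fun x => χ x * θ x) ⊆ tsupport χ := by
    intro θ
    exact closure_mono fun x hx h => hx (by simp [h])
  have sub2 : tsupport (fun x => ψ x * fderiv ℝ χ x e) ⊆ tsupport χ := by
    refine Set.Subset.trans ?_ htdχ
    exact closure_mono fun x hx h => hx (by simp [h])
  have j1 : Integrable (fun x => (χ x * fderiv ℝ ψ x e) • f x) :=
    integrable_smul_of_hasCompactSupport hf (hχ.continuous.mul hdψ)
      (hχc.of_isClosed_subset (isClosed_tsupport _) sub1) (sub1.trans hχΩ)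
  have j2 : Integrable (fun x => (ψ x * fderiv ℝ χ x e) • f x) :=
    integrable_smul_of_hasCompactSupport hf (hψ.continuous.mul hdχ)
      (hχc.of_isClosed_subset (isClosed_tsupport _) sub2) (sub2.trans hχΩ)
  have j3 : Integrable (fun x => (χ x * ψ x) • g x) :=
    integrable_smul_of_hasCompactSupport hg (hχ.continuous.mul hψ.continuous)
      (hχc.of_isClosed_subset (isClosed_tsupport _) sub1) (sub1.trans hχΩ)
  simp only [hdp, add_smul] at h1
  rw [integral_add j1 j2] at h1
  have h2 : ∫ x, ψ x • (fderiv ℝ χ x e • f x + χ x • g x) =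
      (∫ x, (ψ x * fderiv ℝ χ x e) • f x) + ∫ x, (χ x * ψ x) • g x := by
    rw [← integral_add j2 j3]
    refine integral_congr_ae (Eventually.of_forall fun x => ?_)
    simp only [smul_add, smul_smul, mul_comm (χ x)]
  have h3 : ∫ x, fderiv ℝ ψ x e • (χ x • f x) = ∫ x, (χ x * fderiv ℝ ψ x e) • f x := by
    refine integral_congr_ae (Eventually.of_forall fun x => ?_)
    simp only [smul_smul, mul_comm (χ x)]
  rw [h2, h3, neg_add, ← h1]
  abel

/-- A compactly supported weakly differentiable function is the limit of continuously
differentiable functions, almost everywhere with domination. -/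
theorem exists_contDiff_approx [FiniteDimensional ℝ H] {f g : EuclideanSpace ℝ (Fin n) → H}
    {e : EuclideanSpace ℝ (Fin n)} (hf : Integrable f) (hg : Integrable g)
    (hfg : ∀ φ : EuclideanSpace ℝ (Fin n) → ℝ, ContDiff ℝ 1 φ → HasCompactSupport φ →
      ∫ x, fderiv ℝ φ x e • f x = - ∫ x, φ x • g x) :
    ∃ F : ℕ → EuclideanSpace ℝ (Fin n) → H, (∀ j, ContDiff ℝ 1 (F j)) ∧
      (∀ᵐ x, Tendsto (fun j => F j x) atTop (𝓝 (f x))) ∧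
      (∀ᵐ x, Tendsto (fun j => fderiv ℝ (F j) x e) atTop (𝓝 (g x))) ∧
      (∃ Φ : EuclideanSpace ℝ (Fin n) → ℝ, Integrable Φ ∧ ∀ᵐ x, ∀ j, ‖F j x‖ ≤ Φ x) ∧
      ∃ Φ : EuclideanSpace ℝ (Fin n) → ℝ, Integrable Φ ∧ ∀ᵐ x, ∀ j, ‖fderiv ℝ (F j) x e‖ ≤ Φ x := by
  have : CompleteSpace H := FiniteDimensional.complete ℝ H
  let F : ℕ → EuclideanSpace ℝ (Fin n) → H := fun j =>
    convolution ((shrinkingBump _ j).normed volume) f (ContinuousLinearMap.lsmul ℝ ℝ) volume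
  let G : ℕ → EuclideanSpace ℝ (Fin n) → H := fun j =>
    convolution ((shrinkingBump _ j).normed volume) g (ContinuousLinearMap.lsmul ℝ ℝ) volume
  have hFG : ∀ j x, fderiv ℝ (F j) x e = G j x := fun j x =>
    fderiv_mollify_apply _ hf.locallyIntegrable hfg x
  have hFi : ∀ j, Integrable (F j) := fun j =>
    (shrinkingBump _ j).integrable_normed.integrable_convolution _ hf
  have hGi : ∀ j, Integrable (G j) := fun j =>
    (shrinkingBump _ j).integrable_normed.integrable_convolution _ hg
  have hFd : ∀ j, ContDiff ℝ 1 (F j) := fun j =>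
    (shrinkingBump _ j).hasCompactSupport_normed.contDiff_convolution_left (n := 1) _
      (shrinkingBump _ j).contDiff_normed hf.locallyIntegrable
  -- The index `Bool` carries the function and its derivative, so that one subsequence serves both.
  obtain ⟨ns, -, h⟩ := exists_subseq_ae_tendsto_and_dominated (ι := Bool) (p := 1) le_rfl
    ENNReal.one_ne_top (μ := (volume : Measure (EuclideanSpace ℝ (Fin n))))
    (f := fun b j => if b then F j else G j) (g := fun b => if b then f else g)
    (by rintro (_ | _) m; exacts [(hGi m).1, (hFi m).1])
    (by rintro (_ | _); exacts [memLp_one_iff_integrable.2 hg, memLp_one_iff_integrable.2 hf])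
    (by rintro (_ | _); exacts [tendsto_eLpNorm_mollify_sub hg, tendsto_eLpNorm_mollify_sub hf])
  obtain ⟨h1, Φ, h2, h3⟩ := h true
  obtain ⟨h4, Ψ, h5, h6⟩ := h false
  refine ⟨fun j => F (ns j), fun j => hFd _, h1, ?_, ⟨Φ, memLp_one_iff_integrable.1 h2, h3⟩,
    ⟨Ψ, memLp_one_iff_integrable.1 h5, ?_⟩⟩
  · simpa [hFG] using h4
  · simpa [hFG] using h6

theorem norm_le_of_fderiv_le {T : H → ℂ} (hT : ContDiff ℝ 1 T) {M : ℝ}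
    (hM : ∀ w, ‖fderiv ℝ T w‖ ≤ M) (w : H) : ‖T w‖ ≤ ‖T 0‖ + M * ‖w‖ := by
  have h := Convex.norm_image_sub_le_of_norm_fderiv_le (𝕜 := ℝ) (f := T) (s := Set.univ)
    (fun x _ => hT.differentiable (by norm_num) x) (fun x _ => hM x) convex_univ
    (Set.mem_univ 0) (Set.mem_univ w)
  rw [sub_zero] at h
  calc ‖T w‖ = ‖T 0 + (T w - T 0)‖ := by congr 1; abel
    _ ≤ _ := (norm_add_le _ _).trans (by gcongr)

/-- The chain rule for weakly differentiable functions. -/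
theorem hasWeakPartial_comp [FiniteDimensional ℝ H] (hΩ : IsOpen Ω) {i : Fin n}
    {f g : EuclideanSpace ℝ (Fin n) → H} (hf : LocallyIntegrableOn f Ω)
    (hg : LocallyIntegrableOn g Ω)
    (hfg : ∀ φ : EuclideanSpace ℝ (Fin n) → ℝ, ContDiff ℝ 1 φ → HasCompactSupport φ →
      tsupport φ ⊆ Ω → ∫ x in Ω, fderiv ℝ φ x (EuclideanSpace.single i 1) • f x =
        - ∫ x in Ω, φ x • g x)
    {T : H → ℂ} (hT : ContDiff ℝ 1 T) {M : ℝ} (hM : ∀ w, ‖fderiv ℝ T w‖ ≤ M) :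
    HasWeakPartial Ω i (fun x => T (f x)) (fun x => fderiv ℝ T (f x) (g x)) := by
  set e : EuclideanSpace ℝ (Fin n) := EuclideanSpace.single i 1 with he
  have hM0 : 0 ≤ M := (norm_nonneg _).trans (hM 0)
  have hT' : Continuous (fderiv ℝ T) := hT.continuous_fderiv (by norm_num)
  have hT'' : Continuous (fun q : H × H => fderiv ℝ T q.1 q.2) :=
    (hT'.comp continuous_fst).clm_apply continuous_snd
  have hTle := norm_le_of_fderiv_le hT hM
  have hT'le : ∀ v w, ‖fderiv ℝ T v w‖ ≤ M * ‖w‖ := fun v w =>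
    (ContinuousLinearMap.le_opNorm _ _).trans (by gcongr; exact hM v)
  have li1 : LocallyIntegrableOn (fun x => T (f x)) Ω := by
    have : LocallyIntegrableOn (fun x => ‖T 0‖ + M * ‖f x‖) Ω :=
      (locallyIntegrableOn_const _).add (hf.norm.smul M)
    refine locallyIntegrableOn_mono_of_restrict this (hT.continuous.comp_aestronglyMeasurable hf.aestronglyMeasurable) ?_
    refine Eventually.of_forall fun x => (hTle _).trans (le_abs_self _)
  have li2 : LocallyIntegrableOn (fun x => fderiv ℝ T (f x) (g x)) Ω := by
    have : LocallyIntegrableOn (fun x => M * ‖g x‖) Ω := hg.norm.smul M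
    refine locallyIntegrableOn_mono_of_restrict this (hT''.comp_aestronglyMeasurable
      (hf.aestronglyMeasurable.prodMk hg.aestronglyMeasurable)) ?_
    refine Eventually.of_forall fun x => (hT'le _ _).trans (le_abs_self _)
  refine ⟨li1, li2, fun φ hφ => ?_⟩
  -- On the support of φ, χ = 1 and ∇χ = 0, so the formula for (f, g) may be proved for (f', g'),
  -- which are integrable on the whole space and can be mollified there.
  obtain ⟨χ, hχ, hχc, hχΩ, hχ1⟩ := exists_cutoff hφ.2.1.isCompact hΩ hφ.2.2
  set f' := fun x => χ x • f x with hf'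
  set g' := fun x => fderiv ℝ χ x e • f x + χ x • g x with hg'
  have htdχ : tsupport (fun x => fderiv ℝ χ x e) ⊆ tsupport χ := tsupport_fderiv_apply_subset ℝ e
  have hfi : Integrable f' := integrable_smul_of_hasCompactSupport hf hχ.continuous hχc hχΩ
  have hgi : Integrable g' :=
    (integrable_smul_of_hasCompactSupport hf (continuous_fderiv_apply_const hχ e)
      (hχc.fderiv_apply ℝ e) (htdχ.trans hχΩ)).add
    (integrable_smul_of_hasCompactSupport hg hχ.continuous hχc hχΩ)
  obtain ⟨F, hF, hFlim, hFlim', ⟨Φ, hΦ, hFΦ⟩, ⟨Ψ, hΨ, hFΨ⟩⟩ := exists_contDiff_approx hfi hgi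
    (fun ψ hψ _ => weak_derivative_cutoff_smul hf hg hfg hχ hχc hχΩ ψ hψ)
  have hdφ : Continuous (fun x => fderiv ℝ φ x e) := continuous_fderiv_apply_const hφ.1 e
  have hdφc : HasCompactSupport (fun x => fderiv ℝ φ x e) := hφ.2.1.fderiv_apply ℝ e
  have hTF : ∀ j, ContDiff ℝ 1 (fun x => T (F j x)) := fun j => hT.comp (hF j)
  have hTF' : ∀ j x, fderiv ℝ (fun x => T (F j x)) x e = fderiv ℝ T (F j x) (fderiv ℝ (F j) x e) := by
    intro j x
    have h := ((hT.differentiable (by norm_num) (F j x)).hasFDerivAt.comp x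
      ((hF j).differentiable (by norm_num) x).hasFDerivAt).fderiv
    rw [Function.comp_def] at h
    rw [h]
    rfl
  have hparts : ∀ j, ∫ x, T (F j x) * fderiv ℝ φ x e =
      - ∫ x, fderiv ℝ T (F j x) (fderiv ℝ (F j) x e) * φ x := by
    intro j
    simp only [← hTF']
    have hc := continuous_fderiv_apply_const (hTF j) e
    refine integral_mul_fderiv_eq_neg_fderiv_mul_of_integrable ?_ ?_ ?_
      (fun x _ => (hTF j).differentiable (by norm_num) x)
      (fun x _ => hφ.1.differentiable (by norm_num) x)
    · exact (hc.mul hφ.1.continuous).integrable_of_hasCompactSupport hφ.2.1.mul_left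
    · exact ((hTF j).continuous.mul hdφ).integrable_of_hasCompactSupport hdφc.mul_left
    · exact ((hTF j).continuous.mul hφ.1.continuous).integrable_of_hasCompactSupport
        hφ.2.1.mul_left
  have bdd : ∀ {ψ : EuclideanSpace ℝ (Fin n) → ℂ} {Θ : EuclideanSpace ℝ (Fin n) → ℝ},
      Continuous ψ → HasCompactSupport ψ → Integrable Θ → Integrable (fun x => Θ x * ‖ψ x‖) := by
    intro ψ Θ hψ hψc hΘ
    obtain ⟨C, hC⟩ := hψ.bounded_above_of_compact_support hψc
    exact hΘ.mul_bdd (c := C) hψ.norm.aestronglyMeasurable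
      (Eventually.of_forall fun x => by simpa using hC x)
  have lim1 : Tendsto (fun j => ∫ x, T (F j x) * fderiv ℝ φ x e) atTop
      (𝓝 (∫ x, T (f' x) * fderiv ℝ φ x e)) := by
    refine tendsto_integral_of_dominated_convergence
      (fun x => ‖T 0‖ * ‖fderiv ℝ φ x e‖ + (M * Φ x) * ‖fderiv ℝ φ x e‖) (fun j =>
        ((hTF j).continuous.mul hdφ).aestronglyMeasurable) ?_ (fun j => ?_) ?_
    · exact ((hdφ.integrable_of_hasCompactSupport hdφc).norm.const_mul _).add
        (bdd hdφ hdφc (hΦ.const_mul M))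
    · filter_upwards [hFΦ] with x hx
      rw [norm_mul, ← add_mul]
      gcongr
      exact (hTle _).trans (by gcongr; exact hx j)
    · filter_upwards [hFlim] with x hx
      exact ((hT.continuous.tendsto _).comp hx).mul_const _
  have lim2 : Tendsto (fun j => ∫ x, fderiv ℝ T (F j x) (fderiv ℝ (F j) x e) * φ x) atTop
      (𝓝 (∫ x, fderiv ℝ T (f' x) (g' x) * φ x)) := by
    refine tendsto_integral_of_dominated_convergence (fun x => (M * Ψ x) * ‖φ x‖) (fun j =>
        ((hT''.comp ((hF j).continuous.prodMk (continuous_fderiv_apply_const (hF j) e))).mul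
          hφ.1.continuous).aestronglyMeasurable) ?_ (fun j => ?_) ?_
    · exact bdd hφ.1.continuous hφ.2.1 (hΨ.const_mul M)
    · filter_upwards [hFΨ] with x hx
      rw [norm_mul]
      gcongr
      exact (hT'le _ _).trans (by gcongr; exact hx j)
    · filter_upwards [hFlim, hFlim'] with x hx hx'
      exact ((hT''.tendsto (f' x, g' x)).comp (hx.prodMk_nhds hx')).mul_const _
  -- The classical chain rule and integration by parts hold for each approximant. Domination
  -- survives composition because T has linear growth and a bounded derivative.
  have hlim := tendsto_nhds_unique lim1 (by simpa only [hparts] using lim2.neg)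
  have on1 : ∀ x, T (f' x) * fderiv ℝ φ x e = T (f x) * fderiv ℝ φ x e := by
    intro x
    by_cases hx : x ∈ tsupport φ
    · simp [hf', (hχ1 x hx).1]
    · have h0 : x ∉ tsupport (fun x => fderiv ℝ φ x e) := fun h =>
        hx (tsupport_fderiv_apply_subset ℝ e h)
      have h1 : fderiv ℝ φ x e = 0 :=
        image_eq_zero_of_notMem_tsupport (f := fun x => fderiv ℝ φ x e) h0
      simp [h1]
  have on2 : ∀ x, fderiv ℝ T (f' x) (g' x) * φ x = fderiv ℝ T (f x) (g x) * φ x := by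
    intro x
    by_cases hx : x ∈ tsupport φ
    · simp [hf', hg', hχ1 x hx]
    · simp [image_eq_zero_of_notMem_tsupport hx]
  simp only [on1, on2] at hlim
  rw [setIntegral_eq_integral_of_tsupport_subset (φ := classicalPartial i φ)
      ((tsupport_fderiv_apply_subset ℝ e).trans hφ.2.2) (fun x hx => by simp [hx]),
    setIntegral_eq_integral_of_tsupport_subset hφ.2.2 (fun x hx => by simp [hx])]
  exact hlim

end ChainRule

end WeakDerivatives

/-! ### Radial maps and the truncation w ↦ w / (1 + κ|w|²) -/

section Radial

variable {H : Type*} [NormedAddCommGroup H] [InnerProductSpace ℝ H]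

/-- The radial map `w ↦ k(|w|²) w`. -/
def radialMap (k : ℝ → ℝ) (w : H) : H := k (‖w‖ ^ 2) • w

theorem contDiff_radialMap {k : ℝ → ℝ} (hk : ∀ t, 0 ≤ t → ContDiffAt ℝ 1 k t) :
    ContDiff ℝ 1 (radialMap k : H → H) := by
  refine contDiff_iff_contDiffAt.2 fun w => ?_
  have h1 : ContDiffAt ℝ 1 (fun w : H => k (‖w‖ ^ 2)) w :=
    (hk _ (sq_nonneg _)).comp w (contDiff_norm_sq ℝ).contDiffAt
  exact h1.smul contDiffAt_id

theorem fderiv_radialMap {k : ℝ → ℝ} {w : H} {d : ℝ} (hk : HasDerivAt k d (‖w‖ ^ 2)) (v : H) :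
    fderiv ℝ (radialMap k) w v = k (‖w‖ ^ 2) • v + (2 * d * inner ℝ w v) • w := by
  have h1 : HasFDerivAt (fun w : H => k (‖w‖ ^ 2)) (d • (2 • innerSL ℝ w)) w :=
    hk.comp_hasFDerivAt w (HasStrictFDerivAt.hasFDerivAt (hasStrictFDerivAt_norm_sq w))
  have h2 : fderiv ℝ (radialMap k) w = _ := (h1.smul (hasFDerivAt_id w)).fderiv
  rw [h2]
  simp
  congr 1
  ring

theorem norm_fderiv_radialMap_le {k : ℝ → ℝ} {w : H} {d M : ℝ}
    (hk : HasDerivAt k d (‖w‖ ^ 2)) (hM : |k (‖w‖ ^ 2)| + 2 * (‖w‖ ^ 2 * |d|) ≤ M) :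
    ‖fderiv ℝ (radialMap k) w‖ ≤ M := by
  refine ContinuousLinearMap.opNorm_le_bound _ (le_trans (by positivity) hM) fun v => ?_
  rw [fderiv_radialMap hk]
  calc ‖k (‖w‖ ^ 2) • v + (2 * d * inner ℝ w v) • w‖
      ≤ |k (‖w‖ ^ 2)| * ‖v‖ + 2 * |d| * |inner ℝ w v| * ‖w‖ := by
        refine (norm_add_le _ _).trans (le_of_eq ?_)
        simp [norm_smul]
    _ ≤ |k (‖w‖ ^ 2)| * ‖v‖ + 2 * |d| * (‖w‖ * ‖v‖) * ‖w‖ := by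
        gcongr
        exact abs_real_inner_le_norm w v
    _ = (|k (‖w‖ ^ 2)| + 2 * (‖w‖ ^ 2 * |d|)) * ‖v‖ := by ring
    _ ≤ M * ‖v‖ := by gcongr

/-- The profile `t ↦ 1 / (1 + κ t)` of the map used to truncate gradients. -/
def truncProfile (κ t : ℝ) : ℝ := (1 + κ * t)⁻¹

theorem hasDerivAt_truncProfile {κ t : ℝ} (hκ : 0 ≤ κ) (ht : 0 ≤ t) :
    HasDerivAt (truncProfile κ) (-κ / (1 + κ * t) ^ 2) t := by
  have h1 : HasDerivAt (fun t => 1 + κ * t) κ t := by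
    simpa using ((hasDerivAt_id t).const_mul κ).const_add 1
  exact h1.fun_inv (by positivity)

theorem contDiff_truncMap {κ : ℝ} (hκ : 0 ≤ κ) :
    ContDiff ℝ 1 (radialMap (truncProfile κ) : H → H) := by
  refine contDiff_radialMap fun t ht => ?_
  have h : ContDiffAt ℝ 1 (fun t => 1 + κ * t) t := by fun_prop
  exact h.inv (by positivity)

theorem truncProfile_nonneg {κ t : ℝ} (hκ : 0 ≤ κ) (ht : 0 ≤ t) : 0 ≤ truncProfile κ t := by
  unfold truncProfile; positivity

theorem truncProfile_le_one {κ t : ℝ} (hκ : 0 ≤ κ) (ht : 0 ≤ t) : truncProfile κ t ≤ 1 :=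
  inv_le_one_of_one_le₀ (by linarith [mul_nonneg hκ ht])

theorem norm_truncMap_le {κ : ℝ} (hκ : 0 ≤ κ) (w : H) :
    ‖radialMap (truncProfile κ) w‖ ≤ ‖w‖ := by
  rw [radialMap, norm_smul, Real.norm_of_nonneg (truncProfile_nonneg hκ (sq_nonneg _))]
  exact mul_le_of_le_one_left (norm_nonneg _) (truncProfile_le_one hκ (sq_nonneg _))

/-- For fixed κ any bound will do: it makes the truncated flux bounded, hence integrable against a
gradient in `L^p` for every p > 1. -/
theorem norm_truncMap_le_const {κ : ℝ} (hκ : 0 < κ) (w : H) :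
    ‖radialMap (truncProfile κ) w‖ ≤ 1 + 1 / κ := by
  rw [radialMap, norm_smul, Real.norm_of_nonneg (truncProfile_nonneg hκ.le (sq_nonneg _)),
    truncProfile, inv_mul_le_iff₀ (by positivity)]
  have h : (1 + κ * ‖w‖ ^ 2) * (1 + 1 / κ) = 1 + ‖w‖ ^ 2 + 1 / κ + κ * ‖w‖ ^ 2 := by
    field_simp
    ring
  have h1 : 0 ≤ 1 / κ + κ * ‖w‖ ^ 2 := by positivity
  rw [h]
  nlinarith [sq_nonneg (‖w‖ - 1), norm_nonneg w]

/-- The profile contributes at most 1 and the radial term at most 2. Independence of κ is the point: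
the derivatives of the truncated flux stay dominated as κ → 0. -/
theorem norm_fderiv_truncMap_le {κ : ℝ} (hκ : 0 ≤ κ) (w : H) :
    ‖fderiv ℝ (radialMap (truncProfile κ)) w‖ ≤ 3 := by
  refine norm_fderiv_radialMap_le (hasDerivAt_truncProfile hκ (sq_nonneg _)) ?_
  have ht : 0 ≤ κ * ‖w‖ ^ 2 := by positivity
  have h1 : |truncProfile κ (‖w‖ ^ 2)| ≤ 1 := by
    rw [abs_of_nonneg (truncProfile_nonneg hκ (sq_nonneg _))]
    exact truncProfile_le_one hκ (sq_nonneg _)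
  have h2 : ‖w‖ ^ 2 * |(-κ / (1 + κ * ‖w‖ ^ 2) ^ 2)| ≤ 1 := by
    rw [abs_div, abs_neg, abs_of_nonneg hκ, abs_of_nonneg (by positivity), ← mul_div_assoc,
      div_le_one (by positivity)]
    nlinarith
  linarith

theorem tendsto_truncMap (w : H) {κ : ℕ → ℝ} (hκ : Tendsto κ atTop (𝓝 0)) :
    Tendsto (fun j => radialMap (truncProfile (κ j)) w) atTop (𝓝 w) := by
  have h : ContinuousAt (fun s : ℝ => (1 + s * ‖w‖ ^ 2)⁻¹ • w) 0 := by
    refine ContinuousAt.smul (ContinuousAt.inv₀ (by fun_prop) (by simp)) continuousAt_const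
  have := h.tendsto.comp hκ
  simp only [zero_mul, add_zero, inv_one, one_smul] at this
  exact this

theorem tendsto_fderiv_truncMap (w v : H) {κ : ℕ → ℝ} (hκ : Tendsto κ atTop (𝓝 0))
    (hκ0 : ∀ j, 0 ≤ κ j) :
    Tendsto (fun j => fderiv ℝ (radialMap (truncProfile (κ j))) w v) atTop (𝓝 v) := by
  have h : ContinuousAt (fun s : ℝ => (1 + s * ‖w‖ ^ 2)⁻¹ • v +
      (2 * (-s / (1 + s * ‖w‖ ^ 2) ^ 2) * inner ℝ w v) • w) 0 := by
    refine ContinuousAt.add ?_ ?_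
    · exact ContinuousAt.smul (ContinuousAt.inv₀ (by fun_prop) (by simp)) continuousAt_const
    · refine ContinuousAt.smul (ContinuousAt.mul (ContinuousAt.mul continuousAt_const
        (ContinuousAt.div (by fun_prop) (by fun_prop) (by simp))) continuousAt_const)
        continuousAt_const
  have := h.tendsto.comp hκ
  simp only [Function.comp_def, zero_mul, add_zero, inv_one, one_smul, neg_zero, zero_div,
    mul_zero, zero_smul] at this
  refine this.congr fun j => ?_
  rw [fderiv_radialMap (hasDerivAt_truncProfile (hκ0 j) (sq_nonneg _))]
  rfl

end Radial

/-! ### A bounded regularization of t ↦ t^{(p-2)/2} -/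

section PowerProfile

/-- A regularization of `t ↦ t ^ ((p - 2) / 2)`. -/
def powerProfile (p ε t : ℝ) : ℝ :=
  (ε + t) ^ ((p - 2) / 2) * (1 + ε * t) ^ (-max ((p - 2) / 2) 0)

variable {p ε t : ℝ}

theorem hasDerivAt_powerProfile (hε : 0 < ε) (ht : 0 ≤ t) :
    HasDerivAt (powerProfile p ε) (powerProfile p ε t *
      ((p - 2) / 2 / (ε + t) - max ((p - 2) / 2) 0 * ε / (1 + ε * t))) t := by
  have h1 : HasDerivAt (fun t => ε + t) 1 t := (hasDerivAt_id t).const_add ε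
  have h2 : HasDerivAt (fun t => 1 + ε * t) ε t := by
    simpa using ((hasDerivAt_id t).const_mul ε).const_add 1
  have p1 : 0 < ε + t := by positivity
  have p2 : 0 < 1 + ε * t := by positivity
  have h3 := (h1.rpow_const (p := (p - 2) / 2) (Or.inl p1.ne')).mul
    (h2.rpow_const (p := -max ((p - 2) / 2) 0) (Or.inl p2.ne'))
  refine (h3 : HasDerivAt (powerProfile p ε) _ t).congr_deriv ?_
  rw [powerProfile, Real.rpow_sub_one p1.ne', Real.rpow_sub_one p2.ne']
  field_simp
  ring

theorem contDiffAt_powerProfile (hε : 0 < ε) (ht : 0 ≤ t) :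
    ContDiffAt ℝ 1 (powerProfile p ε) t := by
  refine ContDiffAt.mul ?_ ?_
  · exact ContDiffAt.rpow_const_of_ne (by fun_prop) (by positivity)
  · exact ContDiffAt.rpow_const_of_ne (by fun_prop) (by positivity)

theorem powerProfile_pos (hε : 0 < ε) (ht : 0 ≤ t) : 0 < powerProfile p ε t := by
  unfold powerProfile; positivity

/-- The logarithmic derivative of the regularized profile lies between `0` and `p - 2`. -/
theorem logDeriv_powerProfile_mem (hε : 0 < ε) (hε1 : ε ≤ 1) (ht : 0 ≤ t) :
    2 * t * ((p - 2) / 2 / (ε + t) - max ((p - 2) / 2) 0 * ε / (1 + ε * t)) ∈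
      Set.uIcc 0 (p - 2) := by
  rcases le_total 0 (p - 2) with hp | hp
  · rw [Set.uIcc_of_le hp, max_eq_left (by linarith)]
    -- The two fractions combine into p - 2 times a number in [0, 1]; it is non-negative because ε ≤
    -- 1.
    have h : 2 * t * ((p - 2) / 2 / (ε + t) - (p - 2) / 2 * ε / (1 + ε * t)) =
        (p - 2) * ((1 - ε ^ 2) * t / ((ε + t) * (1 + ε * t))) := by
      field_simp
      ring
    rw [h]
    have h1 : 0 ≤ 1 - ε ^ 2 := by nlinarith
    refine ⟨by positivity, mul_le_of_le_one_right hp ?_⟩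
    rw [div_le_one (by positivity)]
    nlinarith [mul_nonneg hε.le (sq_nonneg t), mul_nonneg (sq_nonneg ε) ht]
  · rw [Set.uIcc_of_ge hp, max_eq_right (by linarith)]
    have h : 2 * t * ((p - 2) / 2 / (ε + t) - 0 * ε / (1 + ε * t)) =
        (p - 2) * (t / (ε + t)) := by
      field_simp
      ring
    rw [h]
    have h2 : t / (ε + t) ≤ 1 := by rw [div_le_one (by positivity)]; linarith
    have h3 : 0 ≤ t / (ε + t) := by positivity
    constructor <;> nlinarith

/-- For p ≥ 2 the profile is a power of (ε+t)/(1+εt) ≤ 1/ε: the second factor is there to cut off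
growth at infinity. For p ≤ 2 that factor is 1, and ε + t ≥ ε removes the singularity at 0. -/
theorem powerProfile_le (hε : 0 < ε) (hε1 : ε ≤ 1) (ht : 0 ≤ t) :
    powerProfile p ε t ≤ ε ^ (-|(p - 2) / 2|) := by
  rcases le_total 0 ((p - 2) / 2) with hp | hp
  · rw [powerProfile, max_eq_left hp, abs_of_nonneg hp, Real.rpow_neg (by positivity),
      Real.rpow_neg hε.le, ← div_eq_mul_inv, div_le_iff₀ (by positivity), ← div_eq_inv_mul,
      ← Real.div_rpow (by positivity) hε.le]
    refine Real.rpow_le_rpow (by positivity) ?_ hp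
    rw [le_div_iff₀ hε]
    nlinarith
  · rw [powerProfile, max_eq_right hp, abs_of_nonpos hp, neg_zero, Real.rpow_zero, mul_one,
      neg_neg]
    exact Real.rpow_le_rpow_of_nonpos hε (by linarith) hp

/-- Uniform in ε, so it provides the dominating function for the limit. For p ≤ 2 the profile is at
most s^{p-2}, and the extra factor s turns this into s^{p-1}, a positive power. -/
theorem powerProfile_mul_le (hp1 : 1 < p) (hε : 0 < ε) (hε1 : ε ≤ 1) {s : ℝ} (hs : 0 ≤ s) :
    powerProfile p ε (s ^ 2) * s ≤ (1 + s) ^ (p - 1) := by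
  rcases le_total 0 ((p - 2) / 2) with hp | hp
  · have h1 : powerProfile p ε (s ^ 2) ≤ (1 + s) ^ (p - 2) := by
      calc powerProfile p ε (s ^ 2) ≤ (ε + s ^ 2) ^ ((p - 2) / 2) * 1 := by
            unfold powerProfile
            gcongr
            rw [max_eq_left hp]
            exact Real.rpow_le_one_of_one_le_of_nonpos (by nlinarith [sq_nonneg s]) (by linarith)
        _ ≤ ((1 + s) ^ 2) ^ ((p - 2) / 2) := by
            rw [mul_one]
            exact Real.rpow_le_rpow (by positivity) (by nlinarith) hp
        _ = (1 + s) ^ (p - 2) := by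
            rw [← Real.rpow_natCast, ← Real.rpow_mul (by positivity)]
            congr 1
            push_cast
            ring
    have h2 : (1 + s) ^ (p - 1) = (1 + s) ^ (p - 2) * (1 + s) := by
      rw [← Real.rpow_add_one (by positivity)]
      congr 1
      ring
    rw [h2]
    gcongr
    linarith
  · rcases hs.eq_or_lt with rfl | hs'
    · simp
    have h1 : powerProfile p ε (s ^ 2) ≤ s ^ (p - 2) := by
      rw [powerProfile, max_eq_right hp, neg_zero, Real.rpow_zero, mul_one]
      calc (ε + s ^ 2) ^ ((p - 2) / 2) ≤ (s ^ 2) ^ ((p - 2) / 2) :=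
            Real.rpow_le_rpow_of_nonpos (by positivity) (by linarith) hp
        _ = s ^ (p - 2) := by
            rw [← Real.rpow_natCast, ← Real.rpow_mul (by positivity)]
            congr 1
            push_cast
            ring
    calc powerProfile p ε (s ^ 2) * s ≤ s ^ (p - 2) * s := by gcongr
      _ = s ^ (p - 1) := by
          rw [← Real.rpow_add_one hs'.ne']
          congr 1
          ring
      _ ≤ (1 + s) ^ (p - 1) := Real.rpow_le_rpow hs (by linarith) (by linarith)

theorem tendsto_powerProfile {ε : ℕ → ℝ} (hε : Tendsto ε atTop (𝓝 0)) {s : ℝ} (hs : 0 < s) :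
    Tendsto (fun j => powerProfile p (ε j) (s ^ 2)) atTop (𝓝 (s ^ (p - 2))) := by
  have h : ContinuousAt (fun e : ℝ => powerProfile p e (s ^ 2)) 0 := by
    unfold powerProfile
    refine ContinuousAt.mul ?_ ?_
    · exact ContinuousAt.rpow_const (by fun_prop) (Or.inl (by simp [hs.ne']))
    · exact ContinuousAt.rpow_const (by fun_prop) (Or.inl (by simp))
  have h1 := h.tendsto.comp hε
  have h2 : powerProfile p 0 (s ^ 2) = s ^ (p - 2) := by
    rw [powerProfile, zero_mul, add_zero, Real.one_rpow, mul_one, zero_add,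
      ← Real.rpow_natCast, ← Real.rpow_mul hs.le]
    congr 1
    push_cast
    ring
  rwa [h2] at h1

end PowerProfile

/-! ### Positivity of the complex form at a point -/

section PointwiseForm

variable {n : ℕ}

theorem quadForm_eq_sum (B : Matrix (Fin n) (Fin n) ℝ) (X : Fin n → ℝ) :
    quadForm B X = ∑ i, ∑ l, B i l * X l * X i := by
  simp only [quadForm, Matrix.mulVec, dotProduct, Finset.sum_mul]

theorem mulVec_dotProduct_eq_sum (B : Matrix (Fin n) (Fin n) ℝ) (X Y : Fin n → ℝ) :
    (B *ᵥ Y) ⬝ᵥ X = ∑ i, ∑ l, B i l * Y l * X i := by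
  simp only [Matrix.mulVec, dotProduct, Finset.sum_mul]

theorem mulVec_dotProduct_comm {B : Matrix (Fin n) (Fin n) ℝ} (hB : B.IsSymm)
    (X Y : Fin n → ℝ) : (B *ᵥ Y) ⬝ᵥ X = (B *ᵥ X) ⬝ᵥ Y := by
  rw [dotProduct_comm, Matrix.dotProduct_mulVec, ← Matrix.mulVec_transpose, hB.eq]

/-- The real part of the form `⟨B ζ, ζ⟩` for a complex vector `ζ = X + iY`. -/
theorem re_sum_mul_conj {B : Matrix (Fin n) (Fin n) ℂ} (hS : (imMat B).IsSymm) (ζ : Fin n → ℂ) :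
    (∑ i, ∑ l, B i l * ζ l * (starRingEnd ℂ) (ζ i)).re =
      quadForm (reMat B) (fun i => (ζ i).re) + quadForm (reMat B) (fun i => (ζ i).im) := by
  have h := mulVec_dotProduct_comm hS (fun i => (ζ i).re) (fun i => (ζ i).im)
  rw [mulVec_dotProduct_eq_sum, mulVec_dotProduct_eq_sum, ← sub_eq_zero] at h
  rw [quadForm_eq_sum, quadForm_eq_sum, ← sub_zero (_ + _), ← h]
  simp only [← Finset.sum_add_distrib, ← Finset.sum_sub_distrib, Complex.re_sum]
  refine Finset.sum_congr rfl fun i _ => Finset.sum_congr rfl fun l _ => ?_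
  simp only [reMat, imMat, Matrix.map_apply, Complex.mul_re, Complex.mul_im, Complex.conj_re,
    Complex.conj_im]
  ring

theorem re_sum_mul_re (B : Matrix (Fin n) (Fin n) ℂ) (ζ : Fin n → ℂ) :
    (∑ i, ∑ l, B i l * ζ l * ((ζ i).re : ℂ)).re =
      quadForm (reMat B) (fun i => (ζ i).re) -
        (imMat B *ᵥ (fun i => (ζ i).im)) ⬝ᵥ (fun i => (ζ i).re) := by
  rw [mulVec_dotProduct_eq_sum, quadForm_eq_sum]
  simp only [← Finset.sum_sub_distrib, Complex.re_sum]
  refine Finset.sum_congr rfl fun i _ => Finset.sum_congr rfl fun l _ => ?_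
  simp only [reMat, imMat, Matrix.map_apply, Complex.mul_re, Complex.mul_im, Complex.ofReal_re,
    Complex.ofReal_im]
  ring

/-- Here τ is the logarithmic derivative of the radial factor. Multiplying by |z|² = z z̄ and
setting ζ = z̄w rotates the phase of z away: the expression becomes k times ⟨Bζ,ζ⟩ + τ⟨Bζ, Re ζ⟩,
whose real part is the form in `hQ` with X = Re ζ and Y = Im ζ. At z = 0 the relation `hd` forces τ
= 0. -/
theorem re_form_radial_nonneg {B : Matrix (Fin n) (Fin n) ℂ} (hS : (imMat B).IsSymm) {τ : ℝ}
    (hQ : ∀ X Y : Fin n → ℝ, 0 ≤ (1 + τ) * quadForm (reMat B) X + quadForm (reMat B) Y -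
      τ * ((imMat B *ᵥ Y) ⬝ᵥ X))
    (w : Fin n → ℂ) (z : ℂ) {k d : ℝ} (hk : 0 < k) (hd : 2 * d * ‖z‖ ^ 2 = τ * k) :
    0 ≤ (∑ i, (∑ l, B i l * w l) *
      (starRingEnd ℂ) (k • w i + (2 * d * inner ℝ z (w i)) • z)).re := by
  rcases eq_or_ne z 0 with rfl | hz
  · have hτ : τ = 0 := by
      have : τ * k = 0 := by simpa using hd.symm
      exact (mul_eq_zero.1 this).resolve_right hk.ne'
    have h1 : ∑ i, (∑ l, B i l * w l) *
        (starRingEnd ℂ) (k • w i + (2 * d * inner ℝ 0 (w i)) • 0) =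
        k * ∑ i, ∑ l, B i l * w l * (starRingEnd ℂ) (w i) := by
      simp only [Finset.sum_mul, Finset.mul_sum]
      refine Finset.sum_congr rfl fun i _ => Finset.sum_congr rfl fun l _ => ?_
      simp
      ring
    rw [h1, Complex.re_ofReal_mul, re_sum_mul_conj hS]
    have := hQ (fun i => (w i).re) (fun i => (w i).im)
    simp only [hτ, zero_mul, add_zero, one_mul, sub_zero] at this
    positivity
  · have hz2 : 0 < ‖z‖ ^ 2 := by positivity
    set ζ : Fin n → ℂ := fun i => (starRingEnd ℂ) z * w i with hζ
    have hin : ∀ i, inner ℝ z (w i) = (ζ i).re := fun i => by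
      simp [hζ, Complex.inner, mul_comm]
    have hzz : ((‖z‖ ^ 2 : ℝ) : ℂ) = z * (starRingEnd ℂ) z := by
      rw [Complex.mul_conj, Complex.normSq_eq_norm_sq]
    have h1 : ((‖z‖ ^ 2 : ℝ) : ℂ) * (∑ i, (∑ l, B i l * w l) *
        (starRingEnd ℂ) (k • w i + (2 * d * inner ℝ z (w i)) • z)) =
        k * ∑ i, ∑ l, B i l * ζ l * (starRingEnd ℂ) (ζ i) +
        ((τ * k : ℝ) : ℂ) * ∑ i, ∑ l, B i l * ζ l * ((ζ i).re : ℂ) := by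
      rw [← hd]
      simp only [hin, Finset.sum_mul, Finset.mul_sum, ← Finset.sum_add_distrib]
      refine Finset.sum_congr rfl fun i _ => Finset.sum_congr rfl fun l _ => ?_
      have e1 : (starRingEnd ℂ) (ζ i) = z * (starRingEnd ℂ) (w i) := by simp [hζ]
      have e2 : ζ l = (starRingEnd ℂ) z * w l := rfl
      rw [e1, e2]
      generalize (ζ i).re = c
      simp only [map_add, Complex.real_smul, map_mul, Complex.conj_ofReal, Complex.ofReal_mul,
        hzz, Complex.ofReal_ofNat, map_ofNat]
      ring
    have h2 := congrArg Complex.re h1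
    rw [Complex.re_ofReal_mul, Complex.add_re, Complex.re_ofReal_mul, Complex.re_ofReal_mul,
      re_sum_mul_conj hS, re_sum_mul_re] at h2
    refine nonneg_of_mul_nonneg_right (a := ‖z‖ ^ 2) ?_ hz2
    rw [h2]
    have := mul_nonneg hk.le (hQ (fun i => (ζ i).re) (fun i => (ζ i).im))
    linarith

end PointwiseForm

/-! ### Integrability estimates and integration by parts against G ∘ u -/

section Sufficiency

variable {n : ℕ} {Ω : Set (EuclideanSpace ℝ (Fin n))}

/-- A crude Young inequality, from comparing both factors with the larger of a and b. -/
theorem mul_rpow_sub_one_le_add {p a b : ℝ} (hp : 1 < p) (ha : 0 ≤ a) (hb : 0 ≤ b) :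
    a * b ^ (p - 1) ≤ a ^ p + b ^ p := by
  have e : ∀ s : ℝ, 0 ≤ s → s ^ p = s * s ^ (p - 1) := fun s hs => by
    rw [← Real.rpow_one_add' hs (by linarith)]
    congr 1
    ring
  have hp1 : 0 ≤ p - 1 := by linarith
  rcases le_total a b with h | h
  · have h1 : a * b ^ (p - 1) ≤ b * b ^ (p - 1) :=
      mul_le_mul_of_nonneg_right h (Real.rpow_nonneg hb _)
    rw [e b hb]
    linarith [Real.rpow_nonneg ha p]
  · have h1 : a * b ^ (p - 1) ≤ a * a ^ (p - 1) :=
      mul_le_mul_of_nonneg_left (Real.rpow_le_rpow hb h hp1) ha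
    rw [e a ha]
    linarith [Real.rpow_nonneg hb p]

theorem integrable_norm_mul_one_add_rpow {α F G : Type*} [MeasurableSpace α] {μ : Measure α}
    [IsFiniteMeasure μ] [NormedAddCommGroup F] [NormedAddCommGroup G] {p : ℝ} (hp : 1 < p)
    {D : α → F} {u : α → G} (hD : MemLp D (ENNReal.ofReal p) μ)
    (hu : MemLp u (ENNReal.ofReal p) μ) :
    Integrable (fun x => ‖D x‖ * (1 + ‖u x‖) ^ (p - 1)) μ := by
  have hp0 : 0 < p := by linarith
  have hq0 : ENNReal.ofReal p ≠ 0 := by simpa using hp0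
  have hv : MemLp (fun x => 1 + ‖u x‖) (ENNReal.ofReal p) μ :=
    MemLp.add (f := fun _ => (1 : ℝ)) (g := fun x => ‖u x‖) (memLp_const (1 : ℝ)) hu.norm
  have h1 := hD.integrable_norm_rpow hq0 ENNReal.ofReal_ne_top
  have h2 := hv.integrable_norm_rpow hq0 ENNReal.ofReal_ne_top
  rw [ENNReal.toReal_ofReal hp0.le] at h1 h2
  refine (h1.add h2).mono' (hD.1.norm.mul
    (hv.1.aemeasurable.pow_const _).aestronglyMeasurable) (Eventually.of_forall fun x => ?_)
  have hb : 0 ≤ 1 + ‖u x‖ := by positivity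
  rw [Real.norm_of_nonneg (by positivity), Pi.add_apply, Real.norm_of_nonneg hb]
  exact (mul_rpow_sub_one_le_add hp (norm_nonneg _) hb)

theorem IsC01.conj_comp {φ : EuclideanSpace ℝ (Fin n) → ℂ} (hφ : IsC01 Ω φ) {G : ℂ → ℂ}
    (hG : ContDiff ℝ 1 G) (hG0 : G 0 = 0) :
    IsC01 Ω (fun x => (starRingEnd ℂ) (G (φ x))) := by
  have h0 : tsupport (fun x => (starRingEnd ℂ) (G (φ x))) ⊆ tsupport φ :=
    closure_mono fun x hx h => hx (by simp [h, hG0])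
  exact ⟨Complex.conjCLE.contDiff.comp (hG.comp hφ.1),
    hφ.2.1.of_isClosed_subset (isClosed_tsupport _) h0, h0.trans hφ.2.2⟩

theorem classicalPartial_conj_comp {φ : EuclideanSpace ℝ (Fin n) → ℂ} (hφ : ContDiff ℝ 1 φ)
    {G : ℂ → ℂ} (hG : ContDiff ℝ 1 G) (i : Fin n) (x : EuclideanSpace ℝ (Fin n)) :
    classicalPartial i (fun x => (starRingEnd ℂ) (G (φ x))) x =
      (starRingEnd ℂ) (fderiv ℝ G (φ x) (classicalPartial i φ x)) := by
  have h1 := (hG.differentiable (by norm_num) (φ x)).hasFDerivAt.comp x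
    (hφ.differentiable (by norm_num) x).hasFDerivAt
  have h2 : fderiv ℝ (fun x => (starRingEnd ℂ) (G (φ x))) x = _ :=
    (Complex.conjCLE.hasFDerivAt.comp x h1).fderiv
  rw [classicalPartial, h2]
  rfl

/-- Integration by parts of a bounded weakly differentiable function against `G ∘ u`, where `u` is
a dominated limit of test functions. -/
theorem HasWeakPartial.integral_mul_conj_comp [IsFiniteMeasure (volume.restrict Ω)] {p : ℝ}
    (hp : 1 < p) {i : Fin n} {W D u v : EuclideanSpace ℝ (Fin n) → ℂ} {C M : ℝ}
    (hWD : HasWeakPartial Ω i W D) (hW : ∀ᵐ x ∂(volume.restrict Ω), ‖W x‖ ≤ C)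
    (hWm : AEStronglyMeasurable W (volume.restrict Ω))
    (hD : MemLp D (ENNReal.ofReal p) (volume.restrict Ω))
    {φ : ℕ → EuclideanSpace ℝ (Fin n) → ℂ} (hφ : ∀ m, IsC01 Ω (φ m))
    {Φ Ψ : EuclideanSpace ℝ (Fin n) → ℝ}
    (hΦ : MemLp Φ (ENNReal.ofReal p) (volume.restrict Ω))
    (hΨ : MemLp Ψ (ENNReal.ofReal p) (volume.restrict Ω))
    (hφu : ∀ᵐ x ∂(volume.restrict Ω), Tendsto (fun m => φ m x) atTop (𝓝 (u x)))
    (hφv : ∀ᵐ x ∂(volume.restrict Ω),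
      Tendsto (fun m => classicalPartial i (φ m) x) atTop (𝓝 (v x)))
    (hφΦ : ∀ᵐ x ∂(volume.restrict Ω), ∀ m, ‖φ m x‖ ≤ Φ x)
    (hφΨ : ∀ᵐ x ∂(volume.restrict Ω), ∀ m, ‖classicalPartial i (φ m) x‖ ≤ Ψ x)
    {G : ℂ → ℂ} (hG : ContDiff ℝ 1 G) (hG0 : G 0 = 0) (hM : ∀ z, ‖fderiv ℝ G z‖ ≤ M)
    (hGp : ∀ z, ‖G z‖ ≤ (1 + ‖z‖) ^ (p - 1)) :
    ∫ x in Ω, W x * (starRingEnd ℂ) (fderiv ℝ G (u x) (v x)) =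
      - ∫ x in Ω, D x * (starRingEnd ℂ) (G (u x)) := by
  have hq1 : (1 : ℝ≥0∞) ≤ ENNReal.ofReal p := by
    rw [← ENNReal.ofReal_one]; exact ENNReal.ofReal_le_ofReal hp.le
  have hM0 : 0 ≤ M := (norm_nonneg _).trans (hM 0)
  have hG' : Continuous (fun q : ℂ × ℂ => fderiv ℝ G q.1 q.2) :=
    ((hG.continuous_fderiv (by norm_num)).comp continuous_fst).clm_apply continuous_snd
  have hdφ : ∀ m, Continuous (classicalPartial i (φ m)) := fun m =>
    continuous_fderiv_apply_const (hφ m).1 _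
  have hparts := fun m => hWD.2.2 _ ((hφ m).conj_comp hG hG0)
  simp only [classicalPartial_conj_comp (hφ _).1 hG] at hparts
  -- Here W and the derivative of G are bounded, so an `L^p` bound for the gradients is enough.
  have lim1 : Tendsto (fun m => ∫ x in Ω, W x *
      (starRingEnd ℂ) (fderiv ℝ G (φ m x) (classicalPartial i (φ m) x))) atTop
      (𝓝 (∫ x in Ω, W x * (starRingEnd ℂ) (fderiv ℝ G (u x) (v x)))) := by
    refine tendsto_integral_of_dominated_convergence (fun x => C * (M * Ψ x)) (fun m => ?_)
      (((hΨ.integrable hq1).const_mul M).const_mul C) (fun m => ?_) ?_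
    · exact hWm.mul (Complex.continuous_conj.comp (hG'.comp ((hφ m).1.continuous.prodMk
        (hdφ m)))).aestronglyMeasurable
    · filter_upwards [hW, hφΨ] with x h1 h2
      rw [norm_mul, RCLike.norm_conj]
      have h3 : ‖fderiv ℝ G (φ m x) (classicalPartial i (φ m) x)‖ ≤ M * Ψ x :=
        (ContinuousLinearMap.le_opNorm _ _).trans (mul_le_mul (hM _) (h2 m) (norm_nonneg _) hM0)
      exact mul_le_mul h1 h3 (norm_nonneg _) ((norm_nonneg _).trans h1)
    · filter_upwards [hφu, hφv] with x h1 h2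
      exact ((Complex.continuous_conj.tendsto _).comp
        ((hG'.tendsto (u x, v x)).comp (h1.prodMk_nhds h2))).const_mul _
  -- Here D is only in `L^p`, and the growth of G with exponent p - 1 is exactly what the pairing
  -- allows.
  have lim2 : Tendsto (fun m => ∫ x in Ω, D x * (starRingEnd ℂ) (G (φ m x))) atTop
      (𝓝 (∫ x in Ω, D x * (starRingEnd ℂ) (G (u x)))) := by
    refine tendsto_integral_of_dominated_convergence (fun x => ‖D x‖ * (1 + ‖Φ x‖) ^ (p - 1))
      (fun m => ?_) (integrable_norm_mul_one_add_rpow hp hD hΦ) (fun m => ?_) ?_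
    · exact hD.1.mul (Complex.continuous_conj.comp
        (hG.continuous.comp (hφ m).1.continuous)).aestronglyMeasurable
    · filter_upwards [hφΦ] with x h1
      rw [norm_mul, RCLike.norm_conj]
      gcongr
      refine (hGp _).trans (Real.rpow_le_rpow (by positivity) ?_ (by linarith))
      gcongr
      exact (h1 m).trans (le_abs_self _)
    · filter_upwards [hφu] with x h1
      exact ((Complex.continuous_conj.tendsto _).comp
        ((hG.continuous.tendsto _).comp h1)).const_mul _
  exact tendsto_nhds_unique lim1 (by simpa only [hparts] using lim2.neg)

theorem IsC1Closure.exists_bound (hΩ : Bornology.IsBounded Ω)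
    {a : EuclideanSpace ℝ (Fin n) → ℂ} (ha : IsC1Closure Ω a) :
    ∃ C, ∀ x ∈ Ω, ‖a x‖ ≤ C ∧ ∀ i, ‖classicalPartial i a x‖ ≤ C := by
  obtain ⟨h1, -, G, hG, hGe⟩ := ha
  have hc : IsCompact (closure Ω) := hΩ.isCompact_closure
  obtain ⟨C1, hC1⟩ := hc.exists_bound_of_continuousOn h1
  obtain ⟨C2, hC2⟩ := hc.exists_bound_of_continuousOn hG
  refine ⟨max C1 C2, fun x hx => ⟨(hC1 x (subset_closure hx)).trans (le_max_left _ _),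
    fun i => ?_⟩⟩
  refine le_trans ?_ ((hC2 x (subset_closure hx)).trans (le_max_right _ _))
  rw [classicalPartial, hGe hx]
  refine (ContinuousLinearMap.le_opNorm _ _).trans ?_
  simp

theorem exists_bound_of_isC1Closure (hΩ : Bornology.IsBounded Ω)
    {A : EuclideanSpace ℝ (Fin n) → Matrix (Fin n) (Fin n) ℂ}
    (hA : ∀ h k, IsC1Closure Ω (fun x => A x h k)) :
    ∃ C, 0 ≤ C ∧ ∀ x ∈ Ω, ∀ h k, ‖A x h k‖ ≤ C ∧
      ∀ i, ‖classicalPartial i (fun x => A x h k) x‖ ≤ C := by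
  choose C hC using fun h k => (hA h k).exists_bound hΩ
  have hle : ∀ h k, C h k ≤ ∑ h, ∑ k, |C h k| := fun h k =>
    (le_abs_self _).trans <| (Finset.single_le_sum (f := fun k => |C h k|)
      (fun _ _ => abs_nonneg _) (Finset.mem_univ k)).trans
      (Finset.single_le_sum (f := fun h => ∑ k, |C h k|)
        (fun _ _ => Finset.sum_nonneg fun _ _ => abs_nonneg _) (Finset.mem_univ h))
  exact ⟨∑ h, ∑ k, |C h k|, Finset.sum_nonneg fun _ _ => Finset.sum_nonneg fun _ _ => abs_nonneg _,
    fun x hx h k => ⟨(hC h k x hx).1.trans (hle h k),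
      fun i => ((hC h k x hx).2 i).trans (hle h k)⟩⟩

/-- Weak differentiability of the components is weak differentiability of the vector. -/
theorem weak_derivative_toLp {w z : Fin n → EuclideanSpace ℝ (Fin n) → ℂ} {i : Fin n}
    (h : ∀ l, HasWeakPartial Ω i (w l) (z l)) (φ : EuclideanSpace ℝ (Fin n) → ℝ)
    (hφ : ContDiff ℝ 1 φ) (hφc : HasCompactSupport φ) (hφs : tsupport φ ⊆ Ω) :
    ∫ x in Ω, fderiv ℝ φ x (EuclideanSpace.single i 1) • WithLp.toLp 2 (fun l => w l x) =
      - ∫ x in Ω, φ x • WithLp.toLp 2 (fun l => z l x) := by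
  have i1 : ∀ l, Integrable (fun x => fderiv ℝ φ x (EuclideanSpace.single i 1) • w l x)
      (volume.restrict Ω) := fun l =>
    (integrable_smul_of_hasCompactSupport (h l).1 (continuous_fderiv_apply_const hφ _)
      (hφc.fderiv_apply ℝ _) ((tsupport_fderiv_apply_subset ℝ _).trans hφs)).restrict
  have i2 : ∀ l, Integrable (fun x => φ x • z l x) (volume.restrict Ω) := fun l =>
    (integrable_smul_of_hasCompactSupport (h l).2.1 hφ.continuous hφc hφs).restrict
  ext l
  rw [PiLp.neg_apply, eval_integral_piLp (fun l => by simpa using i1 l),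
    eval_integral_piLp (fun l => by simpa using i2 l)]
  have hC : IsC01 Ω (fun x => (φ x : ℂ)) := by
    have h0 : tsupport (fun x => (φ x : ℂ)) ⊆ tsupport φ :=
      closure_mono fun x hx h => hx (by simp [h])
    exact ⟨Complex.ofRealCLM.contDiff.comp hφ,
      hφc.of_isClosed_subset (isClosed_tsupport _) h0, h0.trans hφs⟩
  have h1 := (h l).2.2 _ hC
  have h2 : ∀ x, classicalPartial i (fun x => (φ x : ℂ)) x =
      (fderiv ℝ φ x (EuclideanSpace.single i 1) : ℝ) := by
    intro x
    have h3 : fderiv ℝ (fun x => (φ x : ℂ)) x = _ :=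
      (Complex.ofRealCLM.hasFDerivAt.comp x
        (hφ.differentiable (by norm_num) x).hasFDerivAt).fderiv
    rw [classicalPartial, h3]
    rfl
  simpa [h2, mul_comm] using h1

end Sufficiency

/-! ### The regularized duality map z ↦ k(|z|²) z -/

section PowerMap

variable {p ε : ℝ}

theorem contDiff_powerMap (hε : 0 < ε) : ContDiff ℝ 1 (radialMap (powerProfile p ε) : ℂ → ℂ) :=
  contDiff_radialMap fun _ ht => contDiffAt_powerProfile hε ht

theorem norm_powerMap_le (hp : 1 < p) (hε : 0 < ε) (hε1 : ε ≤ 1) (z : ℂ) :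
    ‖radialMap (powerProfile p ε) z‖ ≤ (1 + ‖z‖) ^ (p - 1) := by
  rw [radialMap, norm_smul, Real.norm_of_nonneg (powerProfile_pos hε (sq_nonneg _)).le]
  exact powerProfile_mul_le hp hε hε1 (norm_nonneg z)

theorem norm_fderiv_powerMap_le (hε : 0 < ε) (hε1 : ε ≤ 1) (z : ℂ) :
    ‖fderiv ℝ (radialMap (powerProfile p ε)) z‖ ≤ ε ^ (-|(p - 2) / 2|) * (1 + |p - 2|) := by
  have ht := sq_nonneg ‖z‖
  refine norm_fderiv_radialMap_le (hasDerivAt_powerProfile hε ht) ?_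
  have h1 := logDeriv_powerProfile_mem (p := p) hε hε1 ht
  set L := (p - 2) / 2 / (ε + ‖z‖ ^ 2) - max ((p - 2) / 2) 0 * ε / (1 + ε * ‖z‖ ^ 2)
  have hk := powerProfile_pos (p := p) hε ht
  have h2 : |2 * ‖z‖ ^ 2 * L| ≤ |p - 2| := by
    simpa using Set.abs_sub_left_of_mem_uIcc h1
  rw [abs_mul, abs_of_nonneg (by positivity : 0 ≤ 2 * ‖z‖ ^ 2)] at h2
  rw [abs_mul, abs_of_pos hk]
  calc powerProfile p ε (‖z‖ ^ 2) + 2 * (‖z‖ ^ 2 * (powerProfile p ε (‖z‖ ^ 2) * |L|))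
      = powerProfile p ε (‖z‖ ^ 2) * (1 + 2 * ‖z‖ ^ 2 * |L|) := by ring
    _ ≤ _ := mul_le_mul (powerProfile_le hε hε1 ht) (by linarith) (by positivity) (by positivity)

theorem tendsto_powerMap {ε : ℕ → ℝ} (hε : Tendsto ε atTop (𝓝 0)) (z : ℂ) :
    Tendsto (fun j => radialMap (powerProfile p (ε j)) z) atTop
      (𝓝 (((‖z‖ ^ (p - 2) : ℝ) : ℂ) * z)) := by
  rcases eq_or_ne z 0 with rfl | hz
  · simp [radialMap]
  · have := (tendsto_powerProfile (p := p) hε (norm_pos_iff.2 hz)).smul_const z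
    simpa [radialMap] using this

end PowerMap

/-! ### The truncated flux -/

section Sufficiency

variable {n : ℕ} {Ω : Set (EuclideanSpace ℝ (Fin n))}
  {A : EuclideanSpace ℝ (Fin n) → Matrix (Fin n) (Fin n) ℂ}

/-- The `h`-th component of `𝒜` applied to a truncated vector field. -/
def truncFlux (A : EuclideanSpace ℝ (Fin n) → Matrix (Fin n) (Fin n) ℂ) (κ : ℝ)
    (f : EuclideanSpace ℝ (Fin n) → EuclideanSpace ℂ (Fin n)) (h : Fin n)
    (x : EuclideanSpace ℝ (Fin n)) : ℂ :=
  ∑ l, A x h l * radialMap (truncProfile κ) (f x) l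

/-- The `h`-th partial derivative of the `h`-th component of `𝒜` applied to a truncated vector
field `f` with `h`-th partial derivative `g`. -/
def truncFluxDeriv (A : EuclideanSpace ℝ (Fin n) → Matrix (Fin n) (Fin n) ℂ) (κ : ℝ)
    (f g : EuclideanSpace ℝ (Fin n) → EuclideanSpace ℂ (Fin n)) (h : Fin n)
    (x : EuclideanSpace ℝ (Fin n)) : ℂ :=
  ∑ l, (classicalPartial h (fun y => A y h l) x * radialMap (truncProfile κ) (f x) l +
    A x h l * (fderiv ℝ (radialMap (truncProfile κ)) (f x) (g x)) l)

/-- Each truncated component depends on the whole gradient, so the chain rule is applied to the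
vector field, with T a coordinate of the truncation map; the product rule then handles the
coefficient. -/
theorem hasWeakPartial_truncFlux (hΩ : IsOpen Ω) (hA : ∀ h k, IsC1Closure Ω (fun x => A x h k))
    {κ : ℝ} (hκ : 0 ≤ κ) {w z : Fin n → EuclideanSpace ℝ (Fin n) → ℂ} {h : Fin n}
    (hw : ∀ l, HasWeakPartial Ω h (w l) (z l))
    (hf : LocallyIntegrableOn (fun x => WithLp.toLp 2 (fun l => w l x)) Ω)
    (hg : LocallyIntegrableOn (fun x => WithLp.toLp 2 (fun l => z l x)) Ω) :
    HasWeakPartial Ω h (truncFlux A κ (fun x => WithLp.toLp 2 (fun l => w l x)) h)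
      (truncFluxDeriv A κ (fun x => WithLp.toLp 2 (fun l => w l x))
        (fun x => WithLp.toLp 2 (fun l => z l x)) h) := by
  refine HasWeakPartial.sum Finset.univ fun l _ => HasWeakPartial.mul_left hΩ (hA h l).2.1 ?_
  let P : EuclideanSpace ℂ (Fin n) →L[ℝ] ℂ := PiLp.proj 2 (𝕜 := ℝ) (fun _ : Fin n => ℂ) l
  have hT : ContDiff ℝ 1 (fun v : EuclideanSpace ℂ (Fin n) => P (radialMap (truncProfile κ) v)) :=
    P.contDiff.comp (contDiff_truncMap hκ)
  have hd : ∀ v : EuclideanSpace ℂ (Fin n),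
      fderiv ℝ (fun v : EuclideanSpace ℂ (Fin n) => P (radialMap (truncProfile κ) v)) v =
        P.comp (fderiv ℝ (radialMap (truncProfile κ)) v) := fun v =>
    (P.hasFDerivAt.comp v
      ((contDiff_truncMap hκ).differentiable (by norm_num) v).hasFDerivAt).fderiv
  have hM : ∀ v, ‖fderiv ℝ (fun v : EuclideanSpace ℂ (Fin n) =>
      P (radialMap (truncProfile κ) v)) v‖ ≤ 3 := by
    intro v
    rw [hd]
    refine ContinuousLinearMap.opNorm_le_bound _ (by norm_num) fun y => ?_
    refine (PiLp.norm_apply_le _ l).trans ((ContinuousLinearMap.le_opNorm _ _).trans ?_)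
    gcongr
    exact norm_fderiv_truncMap_le hκ v
  have := hasWeakPartial_comp hΩ hf hg
    (fun φ hφ hφc hφs => weak_derivative_toLp hw φ hφ hφc hφs) hT hM
  simp only [hd] at this
  exact this

theorem norm_truncFlux_le {κ C : ℝ} (hκ : 0 < κ) (hC : 0 ≤ C)
    {f : EuclideanSpace ℝ (Fin n) → EuclideanSpace ℂ (Fin n)} {h : Fin n}
    {x : EuclideanSpace ℝ (Fin n)} (hA : ∀ l, ‖A x h l‖ ≤ C) :
    ‖truncFlux A κ f h x‖ ≤ n * (C * (1 + 1 / κ)) := by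
  calc ‖truncFlux A κ f h x‖ ≤ ∑ _l : Fin n, C * (1 + 1 / κ) := by
        refine norm_sum_le_of_le _ fun l _ => ?_
        rw [norm_mul]
        exact mul_le_mul (hA l) ((PiLp.norm_apply_le _ l).trans (norm_truncMap_le_const hκ _))
          (norm_nonneg _) hC
    _ = _ := by simp

/-- Independent of κ, and in `L^p` when f and g are: the dominating function as κ → 0. -/
theorem norm_truncFluxDeriv_le {κ C : ℝ} (hκ : 0 ≤ κ) (hC : 0 ≤ C)
    {f g : EuclideanSpace ℝ (Fin n) → EuclideanSpace ℂ (Fin n)} {h : Fin n}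
    {x : EuclideanSpace ℝ (Fin n)} (hA : ∀ l, ‖A x h l‖ ≤ C)
    (hA' : ∀ l, ‖classicalPartial h (fun y => A y h l) x‖ ≤ C) :
    ‖truncFluxDeriv A κ f g h x‖ ≤ n * C * (‖f x‖ + 3 * ‖g x‖) := by
  calc ‖truncFluxDeriv A κ f g h x‖ ≤ ∑ _l : Fin n, (C * ‖f x‖ + C * (3 * ‖g x‖)) := by
        refine norm_sum_le_of_le _ fun l _ => (norm_add_le _ _).trans ?_
        rw [norm_mul, norm_mul]
        refine add_le_add ?_ ?_
        · exact mul_le_mul (hA' l) ((PiLp.norm_apply_le _ l).trans (norm_truncMap_le hκ _))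
            (norm_nonneg _) hC
        · refine mul_le_mul (hA l) ((PiLp.norm_apply_le _ l).trans ?_) (norm_nonneg _) hC
          refine (ContinuousLinearMap.le_opNorm _ _).trans ?_
          gcongr
          exact norm_fderiv_truncMap_le hκ _
    _ = _ := by simp; ring

/-- The form inequality for the truncated flux and a regularized power of `u`. -/
theorem re_truncFlux_mul_conj_nonneg {p κ ε : ℝ} (hκ : 0 ≤ κ) (hε : 0 < ε) (hε1 : ε ≤ 1)
    {x : EuclideanSpace ℝ (Fin n)} (hS : (imMat (A x)).IsSymm)
    (hQ : ∀ τ ∈ Set.uIcc 0 (p - 2), ∀ X Y : Fin n → ℝ,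
      0 ≤ (1 + τ) * quadForm (reMat (A x)) X + quadForm (reMat (A x)) Y -
        τ * ((imMat (A x) *ᵥ Y) ⬝ᵥ X))
    (f : EuclideanSpace ℝ (Fin n) → EuclideanSpace ℂ (Fin n)) (z : ℂ) :
    0 ≤ (∑ h, truncFlux A κ f h x *
      (starRingEnd ℂ) (fderiv ℝ (radialMap (powerProfile p ε)) z (f x h))).re := by
  have ht := sq_nonneg ‖z‖
  have hk := powerProfile_pos (p := p) hε ht
  have h1 := re_form_radial_nonneg hS (hQ _ (logDeriv_powerProfile_mem hε hε1 ht))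
    (fun l => f x l) z hk
    (d := powerProfile p ε (‖z‖ ^ 2) *
      ((p - 2) / 2 / (ε + ‖z‖ ^ 2) - max ((p - 2) / 2) 0 * ε / (1 + ε * ‖z‖ ^ 2))) (by ring)
  -- The truncation multiplies the whole vector by one non-negative scalar, which factors out of the
  -- form.
  have h2 : ∑ h, truncFlux A κ f h x *
      (starRingEnd ℂ) (fderiv ℝ (radialMap (powerProfile p ε)) z (f x h)) =
      (truncProfile κ (‖f x‖ ^ 2) : ℂ) * ∑ h, (∑ l, A x h l * f x l) *
        (starRingEnd ℂ) (fderiv ℝ (radialMap (powerProfile p ε)) z (f x h)) := by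
    rw [Finset.mul_sum]
    refine Finset.sum_congr rfl fun h _ => ?_
    rw [truncFlux, ← mul_assoc, Finset.mul_sum]
    congr 1
    refine Finset.sum_congr rfl fun l _ => ?_
    simp only [radialMap, PiLp.smul_apply, Complex.real_smul]
    ring
  rw [h2, Complex.re_ofReal_mul]
  simp only [fderiv_radialMap (hasDerivAt_powerProfile (p := p) hε ht)]
  exact mul_nonneg (truncProfile_nonneg hκ (sq_nonneg _)) h1

end Sufficiency

/-! ### Non-negativity of the form implies dissipativity -/

section Sufficiency

variable {n : ℕ} {Ω : Set (EuclideanSpace ℝ (Fin n))}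
  {A : EuclideanSpace ℝ (Fin n) → Matrix (Fin n) (Fin n) ℂ}

/-- If the form `(1 + τ) ⟨Re 𝒜 X, X⟩ + ⟨Re 𝒜 Y, Y⟩ - τ ⟨Im 𝒜 Y, X⟩` is non-negative for all `τ`
between `0` and `p - 2`, then the operator is `L^p`-dissipative. -/
theorem isLpDissipative_of_form_nonneg (hΩ : IsOpen Ω) (hΩb : Bornology.IsBounded Ω)
    (hA : ∀ h k, IsC1Closure Ω (fun x => A x h k)) (hS : ∀ x ∈ Ω, (imMat (A x)).IsSymm)
    {p : ℝ} (hp : 1 < p)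
    (hQ : ∀ x ∈ Ω, ∀ τ ∈ Set.uIcc 0 (p - 2), ∀ X Y : Fin n → ℝ,
      0 ≤ (1 + τ) * quadForm (reMat (A x)) X + quadForm (reMat (A x)) Y -
        τ * ((imMat (A x) *ᵥ Y) ⬝ᵥ X)) :
    IsLpDissipative Ω A p := by
  intro u hu2 hu10
  have hfin : IsFiniteMeasure (volume.restrict Ω) :=
    isFiniteMeasure_restrict.2 hΩb.measure_lt_top.ne
  have hq1 : (1 : ℝ≥0∞) ≤ ENNReal.ofReal p := by
    rw [← ENNReal.ofReal_one]; exact ENNReal.ofReal_le_ofReal hp.le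
  have hu := hu2.1
  choose v hv hvW using hu2.2
  choose z hz hzp using fun l => (hvW l).2
  have hw : ∀ l, HasWeakPartial Ω l u (weakPartial Ω l u) := fun l =>
    (hv l).hasWeakPartial_weakPartial
  have hwv : ∀ l, weakPartial Ω l u =ᵐ[volume.restrict Ω] v l := fun l =>
    (hv l).weakPartial_ae_eq hΩ
  have hwp : ∀ l, MemLp (weakPartial Ω l u) (ENNReal.ofReal p) (volume.restrict Ω) := fun l =>
    (memLp_congr_ae (hwv l)).2 (hvW l).1
  have hwz : ∀ l h, HasWeakPartial Ω h (weakPartial Ω l u) (z l h) := fun l h =>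
    (hz l h).congr (hwv l).symm EventuallyEq.rfl
  let f : EuclideanSpace ℝ (Fin n) → EuclideanSpace ℂ (Fin n) :=
    fun x => WithLp.toLp 2 (fun l => weakPartial Ω l u x)
  let g : Fin n → EuclideanSpace ℝ (Fin n) → EuclideanSpace ℂ (Fin n) :=
    fun h x => WithLp.toLp 2 (fun l => z l h x)
  have hf : MemLp f (ENNReal.ofReal p) (volume.restrict Ω) := MemLp.of_eval_piLp hwp
  have hg : ∀ h, MemLp (g h) (ENNReal.ofReal p) (volume.restrict Ω) := fun h =>
    MemLp.of_eval_piLp fun l => hzp l h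
  have hfl : LocallyIntegrableOn f Ω := IntegrableOn.locallyIntegrableOn (hf.integrable hq1)
  have hgl : ∀ h, LocallyIntegrableOn (g h) Ω := fun h =>
    IntegrableOn.locallyIntegrableOn ((hg h).integrable hq1)
  obtain ⟨C, hC0, hC⟩ := exists_bound_of_isC1Closure hΩb hA
  have hflux : ∀ {κ : ℝ}, 0 ≤ κ → ∀ h,
      HasWeakPartial Ω h (truncFlux A κ f h) (truncFluxDeriv A κ f (g h) h) := fun hκ h =>
    hasWeakPartial_truncFlux hΩ hA hκ (fun l => hwz l h) hfl (hgl h)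
  have hbd : ∀ h, MemLp (fun x => n * C * (‖f x‖ + 3 * ‖g h x‖)) (ENNReal.ofReal p)
      (volume.restrict Ω) := fun h =>
    MemLp.const_mul (MemLp.add (f := fun x => ‖f x‖) (g := fun x => 3 * ‖g h x‖) hf.norm
      ((hg h).norm.const_mul 3)) _
  have hDle : ∀ {κ : ℝ}, 0 ≤ κ → ∀ h, ∀ x ∈ Ω,
      ‖truncFluxDeriv A κ f (g h) h x‖ ≤ n * C * (‖f x‖ + 3 * ‖g h x‖) := fun hκ h x hx =>
    norm_truncFluxDeriv_le hκ hC0 (fun l => (hC x hx h l).1) (fun l => (hC x hx h l).2 h)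
  have hDp : ∀ {κ : ℝ}, 0 ≤ κ → ∀ h, MemLp (truncFluxDeriv A κ f (g h) h) (ENNReal.ofReal p)
      (volume.restrict Ω) := fun {κ} hκ h => by
    refine (hbd h).mono (hflux hκ h).2.1.aestronglyMeasurable ?_
    rw [ae_restrict_iff' hΩ.measurableSet]
    exact Eventually.of_forall fun x hx => (hDle hκ h x hx).trans (le_abs_self _)
  obtain ⟨φ, hφ, hφ0, hφ1⟩ := hu10.2
  -- `none` stands for u and `some i` for its i-th partial derivative, so one subsequence of test
  -- functions serves all of them.
  obtain ⟨ns, -, hns⟩ := exists_subseq_ae_tendsto_and_dominated (ι := Option (Fin n)) hq1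
    ENNReal.ofReal_ne_top (μ := volume.restrict Ω)
    (f := fun i m => i.elim (φ m) (fun i => classicalPartial i (φ m)))
    (g := fun i => i.elim u (fun i => weakPartial Ω i u))
    (by
      rintro (_ | i) m
      exacts [(hφ m).1.continuous.aestronglyMeasurable,
        (continuous_fderiv_apply_const (hφ m).1 _).aestronglyMeasurable])
    (by rintro (_ | i); exacts [hu, hwp i])
    (by rintro (_ | i); exacts [hφ0, hφ1 i])
  obtain ⟨hφu, Φ, hΦ, hφΦ⟩ := hns none
  choose hφv Ψ hΨ hφΨ using fun i => hns (some i)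
  -- One parameter κ governs both the truncation of the gradient and the regularization of the
  -- power.
  have key : ∀ {κ : ℝ}, 0 < κ → κ ≤ 1 → (∫ x in Ω, ∑ h, truncFluxDeriv A κ f (g h) h x *
      (starRingEnd ℂ) (radialMap (powerProfile p κ) (u x))).re ≤ 0 := by
    intro κ hκ hκ1
    have hG := contDiff_powerMap (p := p) hκ
    have hG' : Continuous (fun q : ℂ × ℂ => fderiv ℝ (radialMap (powerProfile p κ)) q.1 q.2) :=
      ((hG.continuous_fderiv (by norm_num)).comp continuous_fst).clm_apply continuous_snd
    have hGM := norm_fderiv_powerMap_le (p := p) hκ hκ1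
    have hWb : ∀ h, ∀ᵐ x ∂(volume.restrict Ω),
        ‖truncFlux A κ f h x‖ ≤ n * (C * (1 + 1 / κ)) := fun h => by
      rw [ae_restrict_iff' hΩ.measurableSet]
      exact Eventually.of_forall fun x hx => norm_truncFlux_le hκ hC0 fun l => (hC x hx h l).1
    have hWm : ∀ h, AEStronglyMeasurable (truncFlux A κ f h) (volume.restrict Ω) := fun h =>
      (hflux hκ.le h).1.aestronglyMeasurable
    have hparts := fun h => (hflux hκ.le h).integral_mul_conj_comp hp (hWb h) (hWm h)
      (hDp hκ.le h) (fun j => hφ (ns j)) hΦ (hΨ h) hφu (hφv h) hφΦ (hφΨ h) hG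
      (by simp [radialMap]) hGM (norm_powerMap_le hp hκ hκ1)
    have hi1 : ∀ h, Integrable (fun x => truncFluxDeriv A κ f (g h) h x *
        (starRingEnd ℂ) (radialMap (powerProfile p κ) (u x))) (volume.restrict Ω) := fun h => by
      refine (integrable_norm_mul_one_add_rpow hp (hDp hκ.le h) hu).mono'
        ((hDp hκ.le h).1.mul (Complex.continuous_conj.comp_aestronglyMeasurable
          (hG.continuous.comp_aestronglyMeasurable hu.1))) (Eventually.of_forall fun x => ?_)
      rw [norm_mul, RCLike.norm_conj]
      gcongr
      exact norm_powerMap_le hp hκ hκ1 _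
    have hi2 : ∀ h, Integrable (fun x => truncFlux A κ f h x * (starRingEnd ℂ)
        (fderiv ℝ (radialMap (powerProfile p κ)) (u x) (weakPartial Ω h u x)))
        (volume.restrict Ω) := fun h => by
      refine ((((hwp h).integrable hq1).norm.const_mul
        (κ ^ (-|(p - 2) / 2|) * (1 + |p - 2|))).const_mul (n * (C * (1 + 1 / κ)))).mono'
        ((hWm h).mul (Complex.continuous_conj.comp_aestronglyMeasurable
          (hG'.comp_aestronglyMeasurable (hu.1.prodMk (hwp h).1)))) ?_
      filter_upwards [hWb h] with x hx
      rw [norm_mul, RCLike.norm_conj]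
      exact mul_le_mul hx ((ContinuousLinearMap.le_opNorm _ _).trans
        (mul_le_mul_of_nonneg_right (hGM _) (norm_nonneg _))) (norm_nonneg _)
        ((norm_nonneg _).trans hx)
    have h1 : ∫ x in Ω, ∑ h, truncFluxDeriv A κ f (g h) h x *
        (starRingEnd ℂ) (radialMap (powerProfile p κ) (u x)) =
        - ∫ x in Ω, ∑ h, truncFlux A κ f h x * (starRingEnd ℂ)
          (fderiv ℝ (radialMap (powerProfile p κ)) (u x) (weakPartial Ω h u x)) := by
      rw [integral_finsetSum _ fun h _ => hi1 h, integral_finsetSum _ fun h _ => hi2 h,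
        ← Finset.sum_neg_distrib]
      refine Finset.sum_congr rfl fun h _ => ?_
      rw [← neg_eq_iff_eq_neg]
      exact (hparts h).symm
    rw [h1, Complex.neg_re, neg_nonpos]
    have h2 := integral_re (𝕜 := ℂ) (integrable_finsetSum Finset.univ fun h _ => hi2 h)
    simp only [RCLike.re_to_complex] at h2
    rw [← h2]
    refine setIntegral_nonneg hΩ.measurableSet fun x hx => ?_
    exact re_truncFlux_mul_conj_nonneg hκ.le hκ hκ1 (hS x hx) (hQ x hx) f (u x)
  let κ : ℕ → ℝ := fun j => 1 / (j + 1)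
  have hκ0 : ∀ j, 0 < κ j := fun j => by positivity
  have hκ1 : ∀ j, κ j ≤ 1 := fun j => by
    refine div_le_one_of_le₀ ?_ (by positivity)
    have : (0 : ℝ) ≤ j := by positivity
    linarith
  have hκ : Tendsto κ atTop (𝓝 0) := tendsto_one_div_add_atTop_nhds_zero_nat
  let D : Fin n → EuclideanSpace ℝ (Fin n) → ℂ := fun h x =>
    ∑ l, (classicalPartial h (fun y => A y h l) x * weakPartial Ω l u x + A x h l * z l h x)
  -- The limit κ → 0 is taken before integration by parts, where only second derivatives of u meet
  -- the power of u; the form itself need not converge.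
  have hlim : Tendsto (fun j => ∫ x in Ω, ∑ h, truncFluxDeriv A (κ j) f (g h) h x *
      (starRingEnd ℂ) (radialMap (powerProfile p (κ j)) (u x))) atTop
      (𝓝 (∫ x in Ω, ∑ h, D h x *
        (starRingEnd ℂ) (((‖u x‖ ^ (p - 2) : ℝ) : ℂ) * u x))) := by
    refine tendsto_integral_of_dominated_convergence
      (fun x => ∑ h, ‖(n * C * (‖f x‖ + 3 * ‖g h x‖) : ℝ)‖ * (1 + ‖u x‖) ^ (p - 1)) (fun j => ?_)
      (integrable_finsetSum _ fun h _ => integrable_norm_mul_one_add_rpow hp (hbd h) hu)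
      (fun j => ?_) (Eventually.of_forall fun x => ?_)
    · exact Finset.aestronglyMeasurable_fun_sum _ fun h _ => (hDp (hκ0 j).le h).1.mul
        (Complex.continuous_conj.comp_aestronglyMeasurable
          ((contDiff_powerMap (hκ0 j)).continuous.comp_aestronglyMeasurable hu.1))
    · rw [ae_restrict_iff' hΩ.measurableSet]
      refine Eventually.of_forall fun x hx => norm_sum_le_of_le _ fun h _ => ?_
      rw [norm_mul, RCLike.norm_conj]
      exact mul_le_mul ((hDle (hκ0 j).le h x hx).trans (le_abs_self _))
        (norm_powerMap_le hp (hκ0 j) (hκ1 j) _) (norm_nonneg _) (norm_nonneg _)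
    · refine tendsto_finsetSum _ fun h _ => Tendsto.mul (tendsto_finsetSum _ fun l _ => ?_)
        ((Complex.continuous_conj.tendsto _).comp (tendsto_powerMap hκ (u x)))
      have hP : Continuous (fun y : EuclideanSpace ℂ (Fin n) => y l) :=
        (EuclideanSpace.proj (𝕜 := ℂ) l).continuous
      exact (((hP.tendsto _).comp (tendsto_truncMap (f x) hκ)).const_mul _).add
        (((hP.tendsto _).comp
          (tendsto_fderiv_truncMap (f x) (g h x) hκ fun j => (hκ0 j).le)).const_mul _)
  have hle := le_of_tendsto' ((Complex.continuous_re.tendsto _).comp hlim)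
    fun j => key (hκ0 j) (hκ1 j)
  have hD : ∀ h, weakPartial Ω h (fun y => ∑ k, A y h k * weakPartial Ω k u y)
      =ᵐ[volume.restrict Ω] D h := fun h =>
    (HasWeakPartial.sum Finset.univ fun k _ =>
      HasWeakPartial.mul_left hΩ (hA h k).2.1 (hwz k h)).weakPartial_ae_eq hΩ
  have heq : ∫ x in Ω, divFormOp Ω A u x * (starRingEnd ℂ) (u x) * ((‖u x‖ ^ (p - 2) : ℝ) : ℂ) =
      ∫ x in Ω, ∑ h, D h x * (starRingEnd ℂ) (((‖u x‖ ^ (p - 2) : ℝ) : ℂ) * u x) := by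
    refine integral_congr_ae ?_
    filter_upwards [ae_all_iff.2 hD] with x hx
    simp only [divFormOp, hx, map_mul, Complex.conj_ofReal, Finset.sum_mul]
    refine Finset.sum_congr rfl fun h _ => ?_
    ring
  rw [heq]
  exact hle

end Sufficiency

/-! ### Oscillating test functions -/

section Necessity

variable {n : ℕ} {Ω : Set (EuclideanSpace ℝ (Fin n))}
  {A : EuclideanSpace ℝ (Fin n) → Matrix (Fin n) (Fin n) ℂ}

theorem contDiff_classicalPartial {u : EuclideanSpace ℝ (Fin n) → ℂ} (hu : ContDiff ℝ 2 u)
    (i : Fin n) : ContDiff ℝ 1 (classicalPartial i u) :=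
  (hu.fderiv_right (m := 1) (by norm_num)).clm_apply contDiff_const

theorem memW1_of_contDiff {q : ℝ≥0∞} {u : EuclideanSpace ℝ (Fin n) → ℂ} (hu : ContDiff ℝ 1 u)
    (hc : HasCompactSupport u) : MemW1 Ω q u := by
  refine ⟨(hu.continuous.memLp_of_hasCompactSupport hc).restrict _, fun i =>
    ⟨_, hasWeakPartial_classicalPartial i hu, ?_⟩⟩
  have h : HasCompactSupport (classicalPartial i u) := hc.fderiv_apply ℝ _
  exact ((continuous_fderiv_apply_const hu _).memLp_of_hasCompactSupport h).restrict _

theorem memW2_of_contDiff {q : ℝ≥0∞} {u : EuclideanSpace ℝ (Fin n) → ℂ} (hu : ContDiff ℝ 2 u)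
    (hc : HasCompactSupport u) : MemW2 Ω q u :=
  ⟨(hu.continuous.memLp_of_hasCompactSupport hc).restrict _, fun i =>
    ⟨_, hasWeakPartial_classicalPartial i (hu.of_le (by norm_num)),
      memW1_of_contDiff (contDiff_classicalPartial hu i) (hc.fderiv_apply ℝ _)⟩⟩

/-- The constant sequence approximates u, since its classical and weak derivatives agree a.e. -/
theorem IsC01.memW10 (hΩ : IsOpen Ω) {q : ℝ≥0∞} {u : EuclideanSpace ℝ (Fin n) → ℂ}
    (hu : IsC01 Ω u) : MemW10 Ω q u := by
  refine ⟨memW1_of_contDiff hu.1 hu.2.1, fun _ => u, fun _ => hu, ?_, fun i => ?_⟩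
  · simp
  · have h : (fun x => classicalPartial i u x - weakPartial Ω i u x) =ᵐ[volume.restrict Ω]
        (0 : EuclideanSpace ℝ (Fin n) → ℂ) := by
      filter_upwards [(hasWeakPartial_classicalPartial i hu.1).weakPartial_ae_eq hΩ] with x hx
      simp [hx]
    simp only [eLpNorm_congr_ae h]
    simp

/-- The form inequality implied by dissipativity, for a twice continuously differentiable `u` such
that `|u|^{p-2} ū` is a test function. -/
theorem IsLpDissipative.re_integral_form_nonneg (hΩ : IsOpen Ω)
    (hA : ∀ h k, IsC1Closure Ω (fun x => A x h k)) {p : ℝ} (hdiss : IsLpDissipative Ω A p)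
    {u ψ : EuclideanSpace ℝ (Fin n) → ℂ} (hu2 : ContDiff ℝ 2 u) (hu : IsC01 Ω u)
    (hψ : IsC01 Ω ψ)
    (huψ : ∀ x, (starRingEnd ℂ) (u x) * ((‖u x‖ ^ (p - 2) : ℝ) : ℂ) = ψ x) :
    0 ≤ (∫ x in Ω, ∑ h, ∑ k, A x h k * classicalPartial k u x * classicalPartial h ψ x).re := by
  have h0 := hdiss u (memW2_of_contDiff hu2 hu.2.1) (hu.memW10 hΩ)
  have hV : ∀ h, HasWeakPartial Ω h (fun y => ∑ k, A y h k * weakPartial Ω k u y) (fun y => ∑ k,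
      (classicalPartial h (fun y => A y h k) y * weakPartial Ω k u y +
        A y h k * classicalPartial h (classicalPartial k u) y)) := fun h =>
    HasWeakPartial.sum Finset.univ fun k _ => HasWeakPartial.mul_left hΩ (hA h k).2.1
      ((hasWeakPartial_classicalPartial h (contDiff_classicalPartial hu2 k)).congr
        ((hasWeakPartial_classicalPartial k hu.1).weakPartial_ae_eq hΩ).symm EventuallyEq.rfl)
  have hV' := fun h => (hV h).hasWeakPartial_weakPartial
  have h1 : ∫ x in Ω, divFormOp Ω A u x * (starRingEnd ℂ) (u x) * ((‖u x‖ ^ (p - 2) : ℝ) : ℂ) =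
      - ∫ x in Ω, ∑ h, (∑ k, A x h k * weakPartial Ω k u x) * classicalPartial h ψ x := by
    simp only [mul_assoc, huψ]
    simp only [divFormOp, Finset.sum_mul _ _ (ψ _)]
    rw [integral_finsetSum _ fun h _ => hψ.integrable_mul (hV' h).2.1,
      integral_finsetSum _ fun h _ => hψ.integrable_mul_classicalPartial (hV' h).1 h,
      ← Finset.sum_neg_distrib]
    refine Finset.sum_congr rfl fun h _ => ?_
    rw [(hV' h).2.2 ψ hψ, neg_neg]
  have h2 : ∫ x in Ω, ∑ h, (∑ k, A x h k * weakPartial Ω k u x) * classicalPartial h ψ x =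
      ∫ x in Ω, ∑ h, ∑ k, A x h k * classicalPartial k u x * classicalPartial h ψ x := by
    refine integral_congr_ae ?_
    filter_upwards [ae_all_iff.2 fun k =>
      (hasWeakPartial_classicalPartial k hu.1).weakPartial_ae_eq hΩ] with x hx
    simp only [hx, Finset.sum_mul]
  rw [h1, h2, Complex.neg_re] at h0
  linarith

/-- The oscillating phase `t ⟨ξ, x⟩ + β`. -/
def wavePhase (ξ : Fin n → ℝ) (t β : ℝ) (x : EuclideanSpace ℝ (Fin n)) : ℝ :=
  t * inner ℝ (WithLp.toLp 2 ξ) x + β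

/-- The oscillating function `exp (c sin (t ⟨ξ, x⟩ + β))`. -/
def waveExp (c : ℂ) (ξ : Fin n → ℝ) (t β : ℝ) (x : EuclideanSpace ℝ (Fin n)) : ℂ :=
  Complex.exp (c * (Real.sin (wavePhase ξ t β x) : ℂ))

theorem contDiff_waveExp (c : ℂ) (ξ : Fin n → ℝ) (t β : ℝ) {m : WithTop ℕ∞} :
    ContDiff ℝ m (waveExp c ξ t β) := by
  have h1 : ContDiff ℝ m (wavePhase ξ t β) :=
    (contDiff_const.mul (contDiff_const.inner ℝ contDiff_id)).add contDiff_const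
  exact (contDiff_const.mul (Complex.ofRealCLM.contDiff.comp (Real.contDiff_sin.comp h1))).cexp

theorem hasFDerivAt_waveExp (c : ℂ) (ξ : Fin n → ℝ) (t β : ℝ) (x : EuclideanSpace ℝ (Fin n)) :
    ∃ L : EuclideanSpace ℝ (Fin n) →L[ℝ] ℂ, HasFDerivAt (waveExp c ξ t β) L x ∧
      ∀ k, L (EuclideanSpace.single k 1) =
        c * (t * Real.cos (wavePhase ξ t β x) * ξ k : ℝ) * waveExp c ξ t β x := by
  have h1 : HasFDerivAt (wavePhase ξ t β) (t • innerSL ℝ (WithLp.toLp 2 ξ)) x :=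
    (((innerSL ℝ (WithLp.toLp 2 ξ)).hasFDerivAt).const_mul t).add_const β
  have h2 := ((Complex.ofRealCLM.hasFDerivAt.comp x h1.sin).const_mul c).cexp
  refine ⟨_, h2, fun k => ?_⟩
  simp [waveExp, EuclideanSpace.inner_single_right]
  ring

theorem classicalPartial_mul_waveExp {α : EuclideanSpace ℝ (Fin n) → ℝ} (hα : ContDiff ℝ 1 α)
    (c : ℂ) (ξ : Fin n → ℝ) (t β : ℝ) (k : Fin n) (x : EuclideanSpace ℝ (Fin n)) :
    classicalPartial k (fun x => (α x : ℂ) * waveExp c ξ t β x) x =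
      ((fderiv ℝ α x (EuclideanSpace.single k 1) : ℝ) +
        α x * (c * (t * Real.cos (wavePhase ξ t β x) * ξ k : ℝ))) * waveExp c ξ t β x := by
  obtain ⟨L, hL, hLk⟩ := hasFDerivAt_waveExp c ξ t β x
  have h1 := Complex.ofRealCLM.hasFDerivAt.comp x
    (hα.differentiable (by norm_num) x).hasFDerivAt
  have h2 : fderiv ℝ (fun x => (α x : ℂ) * waveExp c ξ t β x) x = _ := (h1.mul hL).fderiv
  rw [classicalPartial, h2]
  simp [hLk]
  ring

theorem isC01_mul_waveExp {α : EuclideanSpace ℝ (Fin n) → ℝ} (hα : ContDiff ℝ 1 α)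
    (hc : HasCompactSupport α) (hs : tsupport α ⊆ Ω) (c : ℂ) (ξ : Fin n → ℝ) (t β : ℝ) :
    IsC01 Ω (fun x => (α x : ℂ) * waveExp c ξ t β x) := by
  have h0 : tsupport (fun x => (α x : ℂ) * waveExp c ξ t β x) ⊆ tsupport α :=
    closure_mono fun x hx h => hx (by simp [h])
  exact ⟨(Complex.ofRealCLM.contDiff.comp hα).mul (contDiff_waveExp c ξ t β),
    hc.of_isClosed_subset (isClosed_tsupport _) h0, h0.trans hs⟩

theorem waveExp_mul_waveExp (c d : ℂ) (ξ : Fin n → ℝ) (t β : ℝ) (x : EuclideanSpace ℝ (Fin n)) :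
    waveExp c ξ t β x * waveExp d ξ t β x = waveExp (c + d) ξ t β x := by
  rw [waveExp, waveExp, waveExp, ← Complex.exp_add, add_mul]

theorem waveExp_ofReal (p : ℝ) (ξ : Fin n → ℝ) (t β : ℝ) (x : EuclideanSpace ℝ (Fin n)) :
    waveExp p ξ t β x = (Real.exp (p * Real.sin (wavePhase ξ t β x)) : ℝ) := by
  simp [waveExp]

/-- The duality map `z ↦ z̄ |z|^{p-2}` on the oscillating functions. -/
theorem conj_mul_norm_rpow_wave {a c p : ℝ} (ha : 0 ≤ a) (hp : 1 < p) (ξ : Fin n → ℝ) (t β : ℝ)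
    (x : EuclideanSpace ℝ (Fin n)) :
    (starRingEnd ℂ) ((a : ℂ) * waveExp (1 + c * Complex.I) ξ t β x) *
      ((‖(a : ℂ) * waveExp (1 + c * Complex.I) ξ t β x‖ ^ (p - 2) : ℝ) : ℂ) =
    ((a ^ (p - 1) : ℝ) : ℂ) * waveExp (p - 1 - c * Complex.I) ξ t β x := by
  -- Where the amplitude vanishes, both sides are zero because 0^{p-1} = 0 for p > 1.
  rcases ha.eq_or_lt with rfl | ha'
  · have : p - 1 ≠ 0 := by linarith
    simp [Real.zero_rpow this]
  set s := Real.sin (wavePhase ξ t β x) with hs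
  have h1 : ‖waveExp (1 + c * Complex.I) ξ t β x‖ = Real.exp s := by
    rw [waveExp, Complex.norm_exp]
    simp [← hs, -Complex.ofReal_sin]
  have h2 : (starRingEnd ℂ) (waveExp (1 + c * Complex.I) ξ t β x) =
      waveExp (1 - c * Complex.I) ξ t β x := by
    rw [waveExp, waveExp, ← Complex.exp_conj]
    simp [← hs, sub_eq_add_neg, -Complex.ofReal_sin]
  have h3 : a ^ (p - 1) = a * a ^ (p - 2) := by
    rw [← Real.rpow_one_add' ha (by linarith)]
    congr 1
    ring
  have h4 : (Real.exp s) ^ (p - 2) = Real.exp ((p - 2) * s) := by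
    rw [← Real.exp_mul, mul_comm]
  have h5 : (p - 1 - c * Complex.I : ℂ) = (1 - c * Complex.I) + ((p - 2 : ℝ) : ℂ) := by
    push_cast
    ring
  rw [norm_mul, h1, Complex.norm_real, Real.norm_of_nonneg ha, map_mul, h2, Complex.conj_ofReal,
    Real.mul_rpow ha (Real.exp_pos _).le, h4, h3, h5, ← waveExp_mul_waveExp, waveExp_ofReal, ← hs]
  simp only [Complex.ofReal_mul]
  ring

end Necessity

/-! ### High frequency asymptotics of the form -/

section Necessity

variable {n : ℕ} {Ω : Set (EuclideanSpace ℝ (Fin n))}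
  {A : EuclideanSpace ℝ (Fin n) → Matrix (Fin n) (Fin n) ℂ}

/-- The coefficient of `t` in the form evaluated at oscillating functions. -/
def waveLinear (B : Matrix (Fin n) (Fin n) ℂ) (μ ν : ℂ) (ξ a g : Fin n → ℝ) (α γ : ℝ) : ℂ :=
  ∑ h, ∑ k, B h k * ((a k * γ : ℝ) * ν * ξ h + (α * g h : ℝ) * μ * ξ k)

/-- The coefficient of `t ^ 0` in the form evaluated at oscillating functions. -/
def waveConst (B : Matrix (Fin n) (Fin n) ℂ) (a g : Fin n → ℝ) : ℂ :=
  ∑ h, ∑ k, B h k * ((a k * g h : ℝ) : ℂ)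

/-- An expansion in powers of t cos θ. For the exponents used below μ + ν = p is real, so the common
factor is positive and the sign for large t is that of the quadratic term. -/
theorem sum_form_wave {α γ : EuclideanSpace ℝ (Fin n) → ℝ} (hα : ContDiff ℝ 1 α)
    (hγ : ContDiff ℝ 1 γ) (μ ν : ℂ) (ξ : Fin n → ℝ) (t β : ℝ) (x : EuclideanSpace ℝ (Fin n)) :
    ∑ h, ∑ k, A x h k * classicalPartial k (fun x => (α x : ℂ) * waveExp μ ξ t β x) x *
        classicalPartial h (fun x => (γ x : ℂ) * waveExp ν ξ t β x) x =
      waveExp (μ + ν) ξ t β x * (((t * Real.cos (wavePhase ξ t β x)) ^ 2 * (α x * γ x) : ℝ) *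
        (μ * ν * ∑ h, ∑ k, A x h k * (ξ k * ξ h : ℝ)) +
        (t * Real.cos (wavePhase ξ t β x) : ℝ) *
          waveLinear (A x) μ ν ξ (fun k => fderiv ℝ α x (EuclideanSpace.single k 1))
            (fun h => fderiv ℝ γ x (EuclideanSpace.single h 1)) (α x) (γ x) +
        waveConst (A x) (fun k => fderiv ℝ α x (EuclideanSpace.single k 1))
            (fun h => fderiv ℝ γ x (EuclideanSpace.single h 1))) := by
  simp only [classicalPartial_mul_waveExp hα, classicalPartial_mul_waveExp hγ,
    ← waveExp_mul_waveExp, waveLinear, waveConst, Finset.mul_sum, ← Finset.sum_add_distrib]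
  refine Finset.sum_congr rfl fun h _ => Finset.sum_congr rfl fun k _ => ?_
  generalize Real.cos (wavePhase ξ t β x) = s
  push_cast
  ring

theorem re_wave_leading (B : Matrix (Fin n) (Fin n) ℂ) (p c : ℝ) (ξ : Fin n → ℝ) :
    ((1 + c * Complex.I) * (p - 1 - c * Complex.I) * ∑ h, ∑ k, B h k * (ξ k * ξ h : ℝ)).re =
      (p - 1 + c ^ 2) * quadForm (reMat B) ξ - (p - 2) * c * quadForm (imMat B) ξ := by
  rw [quadForm_eq_sum, quadForm_eq_sum]
  simp only [Finset.mul_sum, ← Finset.sum_sub_distrib, Complex.re_sum]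
  refine Finset.sum_congr rfl fun h _ => Finset.sum_congr rfl fun k _ => ?_
  simp [reMat, imMat]
  ring

theorem continuousOn_quadForm_re (hA : ∀ h k, IsC1Closure Ω (fun x => A x h k)) (ξ : Fin n → ℝ) :
    ContinuousOn (fun x => quadForm (reMat (A x)) ξ) Ω := by
  simp only [quadForm_eq_sum]
  refine continuousOn_finsetSum _ fun i _ => continuousOn_finsetSum _ fun l _ => ?_
  exact ((Complex.continuous_re.comp_continuousOn ((hA i l).1.mono subset_closure)).mul
    continuousOn_const).mul continuousOn_const

theorem continuousOn_quadForm_im (hA : ∀ h k, IsC1Closure Ω (fun x => A x h k)) (ξ : Fin n → ℝ) :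
    ContinuousOn (fun x => quadForm (imMat (A x)) ξ) Ω := by
  simp only [quadForm_eq_sum]
  refine continuousOn_finsetSum _ fun i _ => continuousOn_finsetSum _ fun l _ => ?_
  exact ((Complex.continuous_im.comp_continuousOn ((hA i l).1.mono subset_closure)).mul
    continuousOn_const).mul continuousOn_const

theorem integrable_coeff_mul (hΩ : IsOpen Ω) (hA : ∀ h k, IsC1Closure Ω (fun x => A x h k))
    {φ : EuclideanSpace ℝ (Fin n) → ℝ} (hφ : Continuous φ) (hc : HasCompactSupport φ)
    (hs : tsupport φ ⊆ Ω) (h k : Fin n) :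
    Integrable (fun x => A x h k * (φ x : ℂ)) (volume.restrict Ω) := by
  have h0 : tsupport (fun x => (φ x : ℂ)) ⊆ tsupport φ :=
    closure_mono fun x hx h => hx (by simp [h])
  exact integrable_mul_of_hasCompactSupport
    (((hA h k).1.mono subset_closure).locallyIntegrableOn hΩ.measurableSet)
    (Complex.continuous_ofReal.comp hφ) (hc.of_isClosed_subset (isClosed_tsupport _) h0)
    (h0.trans hs)

theorem integrable_waveLinear (hΩ : IsOpen Ω) (hA : ∀ h k, IsC1Closure Ω (fun x => A x h k))
    {α γ : EuclideanSpace ℝ (Fin n) → ℝ} (hα : ContDiff ℝ 1 α) (hγ : ContDiff ℝ 1 γ)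
    (hαc : HasCompactSupport α) (hs : tsupport α ⊆ Ω) (μ ν : ℂ) (ξ : Fin n → ℝ) :
    Integrable (fun x => waveLinear (A x) μ ν ξ
      (fun k => fderiv ℝ α x (EuclideanSpace.single k 1))
      (fun h => fderiv ℝ γ x (EuclideanSpace.single h 1)) (α x) (γ x)) (volume.restrict Ω) := by
  refine integrable_finsetSum _ fun h _ => integrable_finsetSum _ fun k _ => ?_
  have hd : tsupport (fun x => fderiv ℝ α x (EuclideanSpace.single k 1)) ⊆ tsupport α :=
    tsupport_fderiv_apply_subset ℝ _
  have i1 := integrable_coeff_mul hΩ hA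
    ((continuous_fderiv_apply_const hα (EuclideanSpace.single k 1)).mul hγ.continuous)
    (hαc.fderiv_apply ℝ _).mul_right (((tsupport_mul_subset_left).trans hd).trans hs) h k
  have i2 := integrable_coeff_mul hΩ hA
    (hα.continuous.mul (continuous_fderiv_apply_const hγ (EuclideanSpace.single h 1)))
    hαc.mul_right ((tsupport_mul_subset_left).trans hs) h k
  refine ((i1.mul_const (ν * ξ h)).add (i2.mul_const (μ * ξ k))).congr
    (Eventually.of_forall fun x => ?_)
  simp only [Pi.add_apply, Pi.mul_apply, Complex.ofReal_mul]
  ring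

theorem integrable_waveConst (hΩ : IsOpen Ω) (hA : ∀ h k, IsC1Closure Ω (fun x => A x h k))
    {α γ : EuclideanSpace ℝ (Fin n) → ℝ} (hα : ContDiff ℝ 1 α) (hγ : ContDiff ℝ 1 γ)
    (hαc : HasCompactSupport α) (hs : tsupport α ⊆ Ω) :
    Integrable (fun x => waveConst (A x)
      (fun k => fderiv ℝ α x (EuclideanSpace.single k 1))
      (fun h => fderiv ℝ γ x (EuclideanSpace.single h 1))) (volume.restrict Ω) := by
  refine integrable_finsetSum _ fun h _ => integrable_finsetSum _ fun k _ => ?_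
  have hd : tsupport (fun x => fderiv ℝ α x (EuclideanSpace.single k 1)) ⊆ tsupport α :=
    tsupport_fderiv_apply_subset ℝ _
  exact integrable_coeff_mul hΩ hA
    ((continuous_fderiv_apply_const hα (EuclideanSpace.single k 1)).mul
      (continuous_fderiv_apply_const hγ (EuclideanSpace.single h 1)))
    (hαc.fderiv_apply ℝ _).mul_right (((tsupport_mul_subset_left).trans hd).trans hs) h k

theorem wavePhase_add_pi_div_two (ξ : Fin n → ℝ) (t : ℝ) (x : EuclideanSpace ℝ (Fin n)) :
    wavePhase ξ t (Real.pi / 2) x = wavePhase ξ t 0 x + Real.pi / 2 := by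
  simp [wavePhase]

/-- A pointwise bound for the sum of the forms at two waves in phase quadrature. -/
theorem re_wave_add_le {p κ t θ w : ℝ} (hp : 0 ≤ p) (hκ : 0 ≤ κ) (ht : 0 ≤ t) {Z L C : ℂ}
    (hw : 0 ≤ w) (hZ : w ≠ 0 → Z.re ≤ -κ) :
    ((Real.exp (p * Real.sin θ) : ℂ) * (((t * Real.cos θ) ^ 2 * w : ℝ) * Z +
        (t * Real.cos θ : ℝ) * L + C)).re +
      ((Real.exp (p * Real.sin (θ + Real.pi / 2)) : ℂ) *
        (((t * Real.cos (θ + Real.pi / 2)) ^ 2 * w : ℝ) * Z +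
        (t * Real.cos (θ + Real.pi / 2) : ℝ) * L + C)).re ≤
      -(t ^ 2 * (κ * Real.exp (-p)) * w) + 2 * Real.exp p * (t * ‖L‖ + ‖C‖) := by
  have key : ∀ φ : ℝ, ((Real.exp (p * Real.sin φ) : ℂ) * (((t * Real.cos φ) ^ 2 * w : ℝ) * Z +
        (t * Real.cos φ : ℝ) * L + C)).re ≤
      -(t ^ 2 * (κ * Real.exp (-p)) * w) * Real.cos φ ^ 2 + Real.exp p * (t * ‖L‖ + ‖C‖) := by
    intro φ
    have e1 : Real.exp (-p) ≤ Real.exp (p * Real.sin φ) :=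
      Real.exp_le_exp.2 (by nlinarith [Real.neg_one_le_sin φ])
    have e2 : Real.exp (p * Real.sin φ) ≤ Real.exp p :=
      Real.exp_le_exp.2 (by nlinarith [Real.sin_le_one φ])
    rw [Complex.re_ofReal_mul, Complex.add_re, Complex.add_re, Complex.re_ofReal_mul,
      Complex.re_ofReal_mul]
    have hwZ : w * Z.re ≤ w * -κ := by
      rcases eq_or_ne w 0 with h | h
      · simp [h]
      · exact mul_le_mul_of_nonneg_left (hZ h) hw
    have h1 : Real.exp (p * Real.sin φ) * ((t * Real.cos φ) ^ 2 * w * Z.re) ≤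
        -(t ^ 2 * (κ * Real.exp (-p)) * w) * Real.cos φ ^ 2 := by
      calc Real.exp (p * Real.sin φ) * ((t * Real.cos φ) ^ 2 * w * Z.re)
          = (Real.exp (p * Real.sin φ) * (t * Real.cos φ) ^ 2) * (w * Z.re) := by ring
        _ ≤ (Real.exp (p * Real.sin φ) * (t * Real.cos φ) ^ 2) * (w * -κ) := by gcongr
        _ = -(Real.exp (p * Real.sin φ) * ((t * Real.cos φ) ^ 2 * w * κ)) := by ring
        _ ≤ -(Real.exp (-p) * ((t * Real.cos φ) ^ 2 * w * κ)) := by gcongr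
        _ = _ := by ring
    have h2 : t * Real.cos φ * L.re + C.re ≤ t * ‖L‖ + ‖C‖ := by
      have h3 : Real.cos φ * L.re ≤ ‖L‖ := by
        refine (le_abs_self _).trans ?_
        rw [abs_mul]
        exact (mul_le_of_le_one_left (abs_nonneg _) (Real.abs_cos_le_one φ)).trans
          (Complex.abs_re_le_norm L)
      have h4 := mul_le_mul_of_nonneg_left h3 ht
      have h5 := Complex.re_le_norm C
      linarith
    have h6 : Real.exp (p * Real.sin φ) * (t * Real.cos φ * L.re + C.re) ≤
        Real.exp p * (t * ‖L‖ + ‖C‖) :=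
      (mul_le_mul_of_nonneg_left h2 (Real.exp_pos _).le).trans
        (mul_le_mul_of_nonneg_right e2 (by positivity))
    linarith
  have h1 := key θ
  have h2 := key (θ + Real.pi / 2)
  -- Phase quadrature: the two squared cosines add up to 1, so the negative term has no zeros in θ.
  have h3 : Real.cos (θ + Real.pi / 2) ^ 2 = 1 - Real.cos θ ^ 2 := by
    rw [Real.cos_add_pi_div_two, neg_sq, Real.sin_sq]
  rw [h3] at h2
  linarith

/-- Dissipativity implies that the leading coefficient of the form is non-negative. -/
theorem IsLpDissipative.wave_leading_nonneg (hΩ : IsOpen Ω)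
    (hA : ∀ h k, IsC1Closure Ω (fun x => A x h k)) {p : ℝ} (hp : 1 < p)
    (hdiss : IsLpDissipative Ω A p) {x₀ : EuclideanSpace ℝ (Fin n)} (hx₀ : x₀ ∈ Ω)
    (ξ : Fin n → ℝ) (c : ℝ) :
    0 ≤ (p - 1 + c ^ 2) * quadForm (reMat (A x₀)) ξ -
      (p - 2) * c * quadForm (imMat (A x₀)) ξ := by
  by_contra! hneg
  set q : EuclideanSpace ℝ (Fin n) → ℝ := fun x =>
    (p - 1 + c ^ 2) * quadForm (reMat (A x)) ξ - (p - 2) * c * quadForm (imMat (A x)) ξ with hq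
  have hqc : ContinuousOn q Ω := (continuousOn_const.mul (continuousOn_quadForm_re hA ξ)).sub
    (continuousOn_const.mul (continuousOn_quadForm_im hA ξ))
  obtain ⟨κ, hκ, hκq⟩ : ∃ κ, 0 < κ ∧ q x₀ < -κ := ⟨-q x₀ / 2, by linarith, by linarith⟩
  have hnhds : ∀ᶠ x in 𝓝 x₀, q x < -κ ∧ x ∈ Ω :=
    ((hqc.continuousAt (hΩ.mem_nhds hx₀)).eventually_lt_const hκq).and (hΩ.mem_nhds hx₀)
  obtain ⟨r, hr, hball⟩ := Metric.eventually_nhds_iff_ball.1 hnhds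
  let χ : ContDiffBump x₀ := ⟨r / 4, r / 2, by positivity, by linarith⟩
  have hχr : χ.rOut < r := by
    change r / 2 < r
    linarith
  -- The dual test function has amplitude α^{p-1} = χ^{m(p-1)}. For p < 2 this could fail to be
  -- differentiable at zeros of χ; m(p-1) ≥ 1 makes it C¹.
  obtain ⟨m, hm⟩ := exists_nat_ge (2 + 1 / (p - 1))
  have hp1 : 0 < p - 1 := by linarith
  have hm2 : (2 : ℝ) ≤ m := by
    have : 0 < 1 / (p - 1) := by positivity
    linarith
  have hmp : 1 ≤ m * (p - 1) := by
    have h1 : 1 / (p - 1) ≤ m := by linarith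
    rwa [div_le_iff₀ hp1] at h1
  have hm0 : m ≠ 0 := by
    rintro rfl
    norm_num at hm2
  let α : EuclideanSpace ℝ (Fin n) → ℝ := fun x => χ x ^ m
  let γ : EuclideanSpace ℝ (Fin n) → ℝ := fun x => χ x ^ ((m : ℝ) * (p - 1))
  have hα : ContDiff ℝ 2 α := (χ.contDiff (n := 2)).pow m
  have hα1 : ContDiff ℝ 1 α := hα.of_le (by norm_num)
  have hγ : ContDiff ℝ 1 γ :=
    (Real.contDiff_rpow_const_of_le (n := 1) (by exact_mod_cast hmp)).comp χ.contDiff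
  have hχs : tsupport χ ⊆ Metric.ball x₀ r := by
    rw [χ.tsupport_eq]
    exact Metric.closedBall_subset_ball hχr
  have hαs : tsupport α ⊆ tsupport χ := closure_mono fun x hx h => hx (by simp [α, h, hm0])
  have hγs : tsupport γ ⊆ tsupport χ := closure_mono fun x hx h => hx (by
    simp [γ, h, Real.zero_rpow (by positivity : (m : ℝ) * (p - 1) ≠ 0)])
  have hbΩ : Metric.ball x₀ r ⊆ Ω := fun x hx => (hball x hx).2
  have hαΩ := (hαs.trans hχs).trans hbΩ
  have hαc : HasCompactSupport α := χ.hasCompactSupport.of_isClosed_subset (isClosed_tsupport _) hαs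
  have hγc : HasCompactSupport γ := χ.hasCompactSupport.of_isClosed_subset (isClosed_tsupport _) hγs
  set μ : ℂ := 1 + c * Complex.I with hμ
  set ν : ℂ := p - 1 - c * Complex.I with hν
  have hμν : μ + ν = (p : ℂ) := by rw [hμ, hν]; ring
  set Z : EuclideanSpace ℝ (Fin n) → ℂ := fun x =>
    μ * ν * ∑ h, ∑ k, A x h k * (ξ k * ξ h : ℝ) with hZ
  have hZq : ∀ x, (Z x).re = q x := fun x => re_wave_leading (A x) p c ξ
  set B : EuclideanSpace ℝ (Fin n) → ℂ := fun x => waveLinear (A x) μ ν ξ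
    (fun k => fderiv ℝ α x (EuclideanSpace.single k 1))
    (fun h => fderiv ℝ γ x (EuclideanSpace.single h 1)) (α x) (γ x)
  set D : EuclideanSpace ℝ (Fin n) → ℂ := fun x => waveConst (A x)
    (fun k => fderiv ℝ α x (EuclideanSpace.single k 1))
    (fun h => fderiv ℝ γ x (EuclideanSpace.single h 1))
  have hB : Integrable B (volume.restrict Ω) := integrable_waveLinear hΩ hA hα1 hγ hαc hαΩ μ ν ξ
  have hD : Integrable D (volume.restrict Ω) := integrable_waveConst hΩ hA hα1 hγ hαc hαΩ
  have hα0 : ∀ x, 0 ≤ α x := fun x => pow_nonneg χ.nonneg m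
  have hγ0 : ∀ x, 0 ≤ γ x := fun x => Real.rpow_nonneg χ.nonneg _
  have hαγ : Continuous (fun x => α x * γ x) := hα.continuous.mul hγ.continuous
  have hαγi : Integrable (fun x => α x * γ x) (volume.restrict Ω) :=
    (hαγ.integrable_of_hasCompactSupport hαc.mul_right).restrict
  let I : ℝ → ℝ → EuclideanSpace ℝ (Fin n) → ℂ := fun t β x =>
    (Real.exp (p * Real.sin (wavePhase ξ t β x)) : ℂ) *
      (((t * Real.cos (wavePhase ξ t β x)) ^ 2 * (α x * γ x) : ℝ) * Z x +
        (t * Real.cos (wavePhase ξ t β x) : ℝ) * B x + D x)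
  have hform : ∀ t β, 0 ≤ (∫ x in Ω, I t β x).re := by
    intro t β
    have h1 := hdiss.re_integral_form_nonneg hΩ hA
      (u := fun x => (α x : ℂ) * waveExp μ ξ t β x) (ψ := fun x => (γ x : ℂ) * waveExp ν ξ t β x)
      ((Complex.ofRealCLM.contDiff.comp hα).mul (contDiff_waveExp μ ξ t β))
      (isC01_mul_waveExp hα1 hαc hαΩ μ ξ t β)
      (isC01_mul_waveExp hγ hγc ((hγs.trans hχs).trans hbΩ) ν ξ t β) (fun x => by
        rw [conj_mul_norm_rpow_wave (hα0 x) hp ξ t β x]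
        simp only [α, γ]
        rw [← Real.rpow_natCast, ← Real.rpow_mul χ.nonneg])
    simp only [sum_form_wave hα1 hγ, hμν, waveExp_ofReal] at h1
    exact h1
  have hI : ∀ t β, Integrable (I t β) (volume.restrict Ω) := by
    intro t β
    have hph : Continuous (wavePhase ξ t β) := by unfold wavePhase; fun_prop
    have hZc : Integrable (fun x => ((α x * γ x : ℝ) : ℂ) * Z x) (volume.restrict Ω) := by
      have : ∀ x, ((α x * γ x : ℝ) : ℂ) * Z x =
          ∑ h, ∑ k, (A x h k * ((α x * γ x : ℝ) : ℂ)) * (μ * ν * (ξ k * ξ h : ℝ)) := by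
        intro x
        simp only [hZ, Finset.mul_sum]
        refine Finset.sum_congr rfl fun h _ => Finset.sum_congr rfl fun k _ => ?_
        ring
      simp only [this]
      exact integrable_finsetSum _ fun h _ => integrable_finsetSum _ fun k _ =>
        (integrable_coeff_mul hΩ hA hαγ hαc.mul_right
          (tsupport_mul_subset_left.trans hαΩ) h k).mul_const _
    have b1 : ∀ x, ‖((t * Real.cos (wavePhase ξ t β x) : ℝ) : ℂ)‖ ≤ |t| := fun x => by
      rw [Complex.norm_real, Real.norm_eq_abs, abs_mul]
      exact mul_le_of_le_one_right (abs_nonneg _) (Real.abs_cos_le_one _)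
    have c1 : Continuous (fun x => ((t * Real.cos (wavePhase ξ t β x) : ℝ) : ℂ)) := by fun_prop
    have c3 : Continuous (fun x => ((t * Real.cos (wavePhase ξ t β x) : ℝ) : ℂ) ^ 2) := c1.pow 2
    have c2 : Continuous (fun x => (Real.exp (p * Real.sin (wavePhase ξ t β x)) : ℂ)) := by
      fun_prop
    have j1 := hZc.bdd_mul (c := |t| ^ 2) c3.aestronglyMeasurable
      (Eventually.of_forall fun x => by
        rw [norm_pow]
        exact pow_le_pow_left₀ (norm_nonneg _) (b1 x) 2)
    have j2 := hB.bdd_mul (c := |t|) c1.aestronglyMeasurable (Eventually.of_forall b1)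
    refine (((j1.add j2).add hD).bdd_mul (c := Real.exp p) c2.aestronglyMeasurable
      (Eventually.of_forall fun x => ?_)).congr (Eventually.of_forall fun x => ?_)
    · rw [Complex.norm_real, Real.norm_of_nonneg (Real.exp_pos _).le]
      exact Real.exp_le_exp.2 (by nlinarith [Real.sin_le_one (wavePhase ξ t β x)])
    · simp only [Pi.add_apply, I]
      push_cast
      ring
  -- The gain is of order t²K, whereas the remaining terms are of order t b + d, with K, b, d
  -- independent of t and β.
  set K := ∫ x in Ω, α x * γ x with hK
  have hKpos : 0 < K := by
    rw [hK, setIntegral_eq_integral_of_tsupport_subset hαΩ (fun x hx => by simp [hx])]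
    refine hαγ.integral_pos_of_hasCompactSupport_nonneg_nonzero hαc.mul_right
      (fun x => mul_nonneg (hα0 x) (hγ0 x)) (x := x₀) ?_
    simp [α, γ, χ.one_of_mem_closedBall (by simp [χ.rIn_pos.le] : x₀ ∈ Metric.closedBall x₀ χ.rIn)]
  set b := ∫ x in Ω, ‖B x‖
  set d := ∫ x in Ω, ‖D x‖
  have hb : 0 ≤ b := integral_nonneg fun x => norm_nonneg _
  have hd : 0 ≤ d := integral_nonneg fun x => norm_nonneg _
  have hmain : ∀ t, 0 ≤ t →
      t ^ 2 * (κ * Real.exp (-p)) * K ≤ 2 * Real.exp p * (t * b + d) := by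
    intro t ht
    have h1 := add_nonneg (hform t 0) (hform t (Real.pi / 2))
    have r1 := integral_re (𝕜 := ℂ) (hI t 0)
    have r2 := integral_re (𝕜 := ℂ) (hI t (Real.pi / 2))
    simp only [RCLike.re_to_complex] at r1 r2
    have hre : ∀ β, Integrable (fun x => (I t β x).re) (volume.restrict Ω) := fun β => (hI t β).re
    rw [← r1, ← r2, ← integral_add (hre 0) (hre (Real.pi / 2))] at h1
    have i1 : Integrable (fun x => t ^ 2 * (κ * Real.exp (-p)) * (α x * γ x))
        (volume.restrict Ω) := hαγi.const_mul _
    have i1' : Integrable (fun x => -(t ^ 2 * (κ * Real.exp (-p)) * (α x * γ x)))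
        (volume.restrict Ω) := i1.neg
    have i2 : Integrable (fun x => 2 * Real.exp p * (t * ‖B x‖ + ‖D x‖)) (volume.restrict Ω) :=
      ((hB.norm.const_mul t).add hD.norm).const_mul _
    have h2 : ∫ x in Ω, ((I t 0 x).re + (I t (Real.pi / 2) x).re) ≤
        ∫ x in Ω, (-(t ^ 2 * (κ * Real.exp (-p)) * (α x * γ x)) +
          2 * Real.exp p * (t * ‖B x‖ + ‖D x‖)) := by
      refine setIntegral_mono_on ((hre 0).add (hre (Real.pi / 2))) (i1'.add i2)
        hΩ.measurableSet fun x _ => ?_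
      simp only [I, wavePhase_add_pi_div_two]
      refine re_wave_add_le (by linarith) hκ.le ht (mul_nonneg (hα0 x) (hγ0 x)) fun hx => ?_
      rw [hZq]
      refine (hball x (hχs (hαs (subset_tsupport _ ?_)))).1.le
      exact left_ne_zero_of_mul hx
    have h3 : ∫ x in Ω, (-(t ^ 2 * (κ * Real.exp (-p)) * (α x * γ x)) +
          2 * Real.exp p * (t * ‖B x‖ + ‖D x‖)) =
        -(t ^ 2 * (κ * Real.exp (-p)) * K) + 2 * Real.exp p * (t * b + d) := by
      rw [integral_add i1' i2, integral_neg, integral_const_mul, integral_const_mul,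
        integral_add (hB.norm.const_mul t) hD.norm, integral_const_mul]
    have h4 := h1.trans (h2.trans h3.le)
    linarith
  set K' := κ * Real.exp (-p) * K with hK'
  have hK'0 : 0 < K' := by positivity
  set M := 2 * Real.exp p * (b + d) with hM
  have hM0 : 0 ≤ M := by positivity
  -- For t ≥ 1 the main inequality gives t²K' ≤ tM, that is tK' ≤ M; this t has tK' = K' + M, a
  -- contradiction.
  have h1 := hmain (1 + M / K') (by positivity)
  have h2 : 1 ≤ 1 + M / K' := by linarith [div_nonneg hM0 hK'0.le]
  set t := 1 + M / K' with ht
  have h3 : 2 * Real.exp p * (t * b + d) ≤ t * M := by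
    have : t * b + d ≤ t * (b + d) := by nlinarith
    calc 2 * Real.exp p * (t * b + d) ≤ 2 * Real.exp p * (t * (b + d)) := by gcongr
      _ = t * M := by rw [hM]; ring
  have h4 : t * (t * K') ≤ t * M := by
    calc t * (t * K') = t ^ 2 * (κ * Real.exp (-p)) * K := by rw [hK']; ring
      _ ≤ _ := h1.trans h3
  have h5 : t * K' ≤ M := le_of_mul_le_mul_left h4 (by linarith)
  have h6 : t * K' = K' + M := by
    rw [ht]
    field_simp
  linarith

/-- Among all c, |c| = √(p-1) minimizes (p-1+c²)/|c|, so it gives the sharpest inequality; the two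
signs produce the absolute value. -/
theorem IsLpDissipative.abs_quadForm_im_le (hΩ : IsOpen Ω)
    (hA : ∀ h k, IsC1Closure Ω (fun x => A x h k)) {p : ℝ} (hp : 1 < p)
    (hdiss : IsLpDissipative Ω A p) {x : EuclideanSpace ℝ (Fin n)} (hx : x ∈ Ω)
    (ξ : Fin n → ℝ) :
    |p - 2| * |quadForm (imMat (A x)) ξ| ≤ 2 * √(p - 1) * quadForm (reMat (A x)) ξ := by
  have hs : 0 < √(p - 1) := Real.sqrt_pos.2 (by linarith)
  have hs2 : √(p - 1) ^ 2 = p - 1 := Real.sq_sqrt (by linarith)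
  have h1 := hdiss.wave_leading_nonneg hΩ hA hp hx ξ (√(p - 1))
  have h2 := hdiss.wave_leading_nonneg hΩ hA hp hx ξ (-√(p - 1))
  rw [neg_sq, hs2] at h2
  rw [hs2] at h1
  rw [← abs_mul]
  refine abs_le.2 ⟨?_, ?_⟩
  · refine le_of_mul_le_mul_left ?_ hs
    nlinarith
  · refine le_of_mul_le_mul_left ?_ hs
    nlinarith

end Necessity

/-! ### Algebra of the criterion: polarization and the interval for p -/

section Criterion

variable {n : ℕ}

theorem quadForm_smul (B : Matrix (Fin n) (Fin n) ℝ) (c : ℝ) (X : Fin n → ℝ) :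
    quadForm B (c • X) = c ^ 2 * quadForm B X := by
  simp only [quadForm, Matrix.mulVec_smul, smul_dotProduct, dotProduct_smul, smul_eq_mul]
  ring

theorem quadForm_add (B : Matrix (Fin n) (Fin n) ℝ) (X Y : Fin n → ℝ) :
    quadForm B (X + Y) = quadForm B X + quadForm B Y + ((B *ᵥ X) ⬝ᵥ Y + (B *ᵥ Y) ⬝ᵥ X) := by
  simp only [quadForm, Matrix.mulVec_add, add_dotProduct, dotProduct_add]
  ring

theorem quadForm_sub (B : Matrix (Fin n) (Fin n) ℝ) (X Y : Fin n → ℝ) :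
    quadForm B (X - Y) = quadForm B X + quadForm B Y - ((B *ᵥ X) ⬝ᵥ Y + (B *ᵥ Y) ⬝ᵥ X) := by
  simp only [quadForm, Matrix.mulVec_sub, sub_dotProduct, dotProduct_sub]
  ring

/-- Polarization recovers the entries of a symmetric matrix from its form. It ensures that λ is the
infimum of a non-empty set. -/
theorem exists_quadForm_ne_zero {B : Matrix (Fin n) (Fin n) ℝ} (hB : B.IsSymm) (h0 : B ≠ 0) :
    ∃ ξ, quadForm B ξ ≠ 0 := by
  by_contra! h
  refine h0 (Matrix.ext fun i j => ?_)
  have h1 := quadForm_add B (Pi.single j 1) (Pi.single i 1)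
  rw [h, h, h, mulVec_dotProduct_comm hB (Pi.single i 1) (Pi.single j 1)] at h1
  have h2 : (B *ᵥ Pi.single i 1) ⬝ᵥ Pi.single j 1 = B j i := by simp
  rw [h2] at h1
  rw [Matrix.zero_apply, ← hB.apply]
  linarith

/-- The polarized form of `l |⟨S ξ, ξ⟩| ≤ ⟨R ξ, ξ⟩`. -/
theorem mul_abs_mulVec_dotProduct_le {R S : Matrix (Fin n) (Fin n) ℝ} (hS : S.IsSymm) {l : ℝ}
    (hl : 0 ≤ l) (h : ∀ ξ, l * |quadForm S ξ| ≤ quadForm R ξ) (X Y : Fin n → ℝ) :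
    2 * l * |(S *ᵥ Y) ⬝ᵥ X| ≤ quadForm R X + quadForm R Y := by
  have h1 := quadForm_add S X Y
  have h2 := quadForm_sub S X Y
  rw [mulVec_dotProduct_comm hS Y X] at h1 h2
  have h3 := h (X + Y)
  have h4 := h (X - Y)
  rw [quadForm_add R] at h3
  rw [quadForm_sub R] at h4
  have h5 : 4 * |(S *ᵥ Y) ⬝ᵥ X| ≤ |quadForm S (X + Y)| + |quadForm S (X - Y)| := by
    have h6 : 4 * ((S *ᵥ Y) ⬝ᵥ X) = quadForm S (X + Y) - quadForm S (X - Y) := by linarith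
    calc 4 * |(S *ᵥ Y) ⬝ᵥ X| = |4 * ((S *ᵥ Y) ⬝ᵥ X)| := by rw [abs_mul]; norm_num
      _ ≤ _ := by rw [h6]; exact abs_sub _ _
  nlinarith

/-- The form inequality follows from `l |⟨S ξ, ξ⟩| ≤ ⟨R ξ, ξ⟩` and `|τ| ≤ 2 l √(1 + τ)`. -/
theorem form_nonneg_of_mul_abs_le {R S : Matrix (Fin n) (Fin n) ℝ} (hS : S.IsSymm) {l τ : ℝ}
    (hl : 0 ≤ l) (h : ∀ ξ, l * |quadForm S ξ| ≤ quadForm R ξ)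
    (hτ : 0 < 1 + τ) (hτl : τ ^ 2 ≤ 4 * l ^ 2 * (1 + τ)) (X Y : Fin n → ℝ) :
    0 ≤ (1 + τ) * quadForm R X + quadForm R Y - τ * ((S *ᵥ Y) ⬝ᵥ X) := by
  set s := √(1 + τ) with hs
  have hs0 : 0 < s := Real.sqrt_pos.2 hτ
  have hs2 : s ^ 2 = 1 + τ := Real.sq_sqrt hτ.le
  -- Rescaling X by √(1+τ) absorbs the coefficient of ⟨RX,X⟩.
  have h1 := mul_abs_mulVec_dotProduct_le hS hl h (s • X) Y
  rw [quadForm_smul, hs2, dotProduct_smul, smul_eq_mul, abs_mul, abs_of_pos hs0] at h1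
  have h2 : |τ| ≤ 2 * l * s := by
    refine abs_le_of_sq_le_sq ?_ (by positivity)
    rw [mul_pow, hs2]
    linarith
  have h3 : τ * ((S *ᵥ Y) ⬝ᵥ X) ≤ 2 * l * s * |(S *ᵥ Y) ⬝ᵥ X| := by
    refine (le_abs_self _).trans ?_
    rw [abs_mul]
    gcongr
  linarith

/-- For p ≥ 2, τ²/(1+τ) increases up to τ = p - 2. For p ≤ 2, moving τ from p - 2 towards 0
decreases τ² and increases 1 + τ. -/
theorem sq_le_of_mem_uIcc {p l τ : ℝ} (hp : 1 < p) (h : (p - 2) ^ 2 ≤ 4 * l ^ 2 * (p - 1))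
    (hτ : τ ∈ Set.uIcc 0 (p - 2)) : 0 < 1 + τ ∧ τ ^ 2 ≤ 4 * l ^ 2 * (1 + τ) := by
  have hl := sq_nonneg l
  rcases le_total 0 (p - 2) with h0 | h0
  · rw [Set.uIcc_of_le h0] at hτ
    obtain ⟨h1, h2⟩ := hτ
    refine ⟨by linarith, ?_⟩
    have e1 : τ ^ 2 * (p - 1) ≤ (p - 2) ^ 2 * (1 + τ) := by
      nlinarith [mul_nonneg h1 h0, mul_nonneg (sub_nonneg.2 h2) (mul_nonneg h1 h0)]
    have e2 : (p - 1) * τ ^ 2 ≤ (p - 1) * (4 * l ^ 2 * (1 + τ)) := by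
      have := mul_le_mul_of_nonneg_right h (by linarith : 0 ≤ 1 + τ)
      linarith
    exact le_of_mul_le_mul_left e2 (by linarith)
  · rw [Set.uIcc_of_ge h0] at hτ
    obtain ⟨h1, h2⟩ := hτ
    refine ⟨by linarith, ?_⟩
    nlinarith [mul_nonneg hl (sub_nonneg.2 h1)]

/-- The interval for `p` in terms of `l`. -/
theorem mem_interval_iff {l p : ℝ} (hl : 0 ≤ l) :
    (2 + 2 * l * (l - √(l ^ 2 + 1)) ≤ p ∧ p ≤ 2 + 2 * l * (l + √(l ^ 2 + 1))) ↔
      (1 < p ∧ (p - 2) ^ 2 ≤ 4 * l ^ 2 * (p - 1)) := by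
  set s := √(l ^ 2 + 1) with hs
  have hs2 : s ^ 2 = l ^ 2 + 1 := Real.sq_sqrt (by positivity)
  have hs0 : 0 ≤ s := Real.sqrt_nonneg _
  have hls : 0 ≤ 2 * l * s := by positivity
  -- Completing the square: the condition is |p - 2 - 2l²| ≤ 2ls.
  have hsq : (p - 2) ^ 2 ≤ 4 * l ^ 2 * (p - 1) ↔ (p - 2 - 2 * l ^ 2) ^ 2 ≤ (2 * l * s) ^ 2 := by
    rw [mul_pow, mul_pow, hs2]
    constructor <;> intro h <;> nlinarith
  have habs : (2 + 2 * l * (l - s) ≤ p ∧ p ≤ 2 + 2 * l * (l + s)) ↔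
      (p - 2) ^ 2 ≤ 4 * l ^ 2 * (p - 1) := by
    rw [hsq, sq_le_sq, abs_of_nonneg hls, abs_le]
    constructor
    · rintro ⟨h1, h2⟩
      constructor <;> nlinarith
    · rintro ⟨h1, h2⟩
      constructor <;> nlinarith
  rw [habs]
  refine ⟨fun h => ⟨?_, h⟩, fun h => h.2⟩
  have h1 := (habs.2 h).1
  -- The lower endpoint equals 1 + (s - l)², and s ≠ l, so it exceeds 1.
  have h2 : 0 < (s - l) ^ 2 := by
    refine sq_pos_of_ne_zero fun h0 => ?_
    have : s = l := by linarith
    rw [this] at hs2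
    linarith
  nlinarith

end Criterion

end

/-! ### The main theorem -/

theorem mainTheorem7 {n : ℕ} (Ω : Set (EuclideanSpace ℝ (Fin n)))
    (hΩ_open : IsOpen Ω) (hΩ_conn : IsConnected Ω) (hΩ_bdd : Bornology.IsBounded Ω)
    (hΩ_bdry : ∃ α : ℝ≥0, α < 1 ∧ HasC2HolderBoundary α Ω)
    (A : EuclideanSpace ℝ (Fin n) → Matrix (Fin n) (Fin n) ℂ)
    (hA : ∀ h k, IsC1Closure Ω (fun x => A x h k))
    (hIm : ∀ x ∈ Ω, (imMat (A x)).IsSymm)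
    (hRe : ∀ x ∈ Ω, ∀ ξ : Fin n → ℝ, 0 ≤ quadForm (reMat (A x)) ξ) :
    ((∀ x ∈ Ω, imMat (A x) = 0) → ∀ p : ℝ, 1 < p → IsLpDissipative Ω A p) ∧
    ((∃ x ∈ Ω, imMat (A x) ≠ 0) →
      ∀ p : ℝ, (1 < p ∧ IsLpDissipative Ω A p) ↔
        (2 + 2 * lambdaInf Ω A * (lambdaInf Ω A - √(lambdaInf Ω A ^ 2 + 1)) ≤ p ∧
          p ≤ 2 + 2 * lambdaInf Ω A * (lambdaInf Ω A + √(lambdaInf Ω A ^ 2 + 1)))) := by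
  refine ⟨fun h0 p hp => ?_, fun h0 p => ?_⟩
  · refine isLpDissipative_of_form_nonneg hΩ_open hΩ_bdd hA hIm hp fun x hx τ hτ X Y => ?_
    have hτ1 : 0 ≤ 1 + τ := by
      rcases Set.mem_uIcc.1 hτ with h | h <;> linarith [h.1]
    rw [h0 x hx, Matrix.zero_mulVec, zero_dotProduct, mul_zero, sub_zero]
    exact add_nonneg (mul_nonneg hτ1 (hRe x hx X)) (hRe x hx Y)
  · have hbdd : BddBelow {r : ℝ | ∃ x ∈ Ω, ∃ ξ : Fin n → ℝ, quadForm (imMat (A x)) ξ ≠ 0 ∧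
        r = quadForm (reMat (A x)) ξ / |quadForm (imMat (A x)) ξ|} := by
      refine ⟨0, ?_⟩
      rintro r ⟨x, hx, ξ, -, rfl⟩
      exact div_nonneg (hRe x hx ξ) (abs_nonneg _)
    have hne : {r : ℝ | ∃ x ∈ Ω, ∃ ξ : Fin n → ℝ, quadForm (imMat (A x)) ξ ≠ 0 ∧
        r = quadForm (reMat (A x)) ξ / |quadForm (imMat (A x)) ξ|}.Nonempty := by
      obtain ⟨x, hx, hx0⟩ := h0
      obtain ⟨ξ, hξ⟩ := exists_quadForm_ne_zero (hIm x hx) hx0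
      exact ⟨_, x, hx, ξ, hξ, rfl⟩
    have hl0 : 0 ≤ lambdaInf Ω A := by
      refine le_csInf hne ?_
      rintro r ⟨x, hx, ξ, -, rfl⟩
      exact div_nonneg (hRe x hx ξ) (abs_nonneg _)
    rw [mem_interval_iff hl0]
    refine and_congr_right fun hp => ⟨fun hdiss => ?_, fun hpl => ?_⟩
    · have hs : 0 < √(p - 1) := Real.sqrt_pos.2 (by linarith)
      have hs2 : √(p - 1) ^ 2 = p - 1 := Real.sq_sqrt (by linarith)
      -- The pointwise necessary condition says that this number is a lower bound for all the
      -- quotients defining λ.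
      have h1 : |p - 2| / (2 * √(p - 1)) ≤ lambdaInf Ω A := by
        refine le_csInf hne ?_
        rintro r ⟨x, hx, ξ, hξ, rfl⟩
        rw [div_le_div_iff₀ (by positivity) (abs_pos.2 hξ)]
        have := hdiss.abs_quadForm_im_le hΩ_open hA hp hx ξ
        linarith
      rw [div_le_iff₀ (by positivity)] at h1
      calc (p - 2) ^ 2 = |p - 2| ^ 2 := (sq_abs _).symm
        _ ≤ (lambdaInf Ω A * (2 * √(p - 1))) ^ 2 := by gcongr
        _ = 4 * lambdaInf Ω A ^ 2 * (p - 1) := by rw [mul_pow, mul_pow, hs2]; ring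
    · refine isLpDissipative_of_form_nonneg hΩ_open hΩ_bdd hA hIm hp fun x hx τ hτ X Y => ?_
      obtain ⟨h1, h2⟩ := sq_le_of_mem_uIcc hp hpl hτ
      refine form_nonneg_of_mul_abs_le (hIm x hx) hl0 (fun ξ => ?_) h1 h2 X Y
      -- Vectors on which the imaginary form vanishes do not enter λ; for them positivity of the
      -- real form suffices.
      rcases eq_or_ne (quadForm (imMat (A x)) ξ) 0 with hξ | hξ
      · rw [hξ, abs_zero, mul_zero]
        exact hRe x hx ξ
      · rw [← le_div_iff₀ (abs_pos.2 hξ)]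
        exact csInf_le hbdd ⟨x, hx, ξ, hξ, rfl⟩
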